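/- Let $M$ be a finite-dimensional $\sigma$-compact (Hausdorff, smooth) manifold without boundary, let $\mathfrak g$ be a finite-dimensional real Lie algebra that is perfect, $[\mathfrak g,\mathfrak g]=\mathfrak g$, and let $\pi\colon\mathfrak K\to M$ be a Lie algebra bundle with typical fiber $\mathfrak g$, i.e. a smooth vector bundle whose fibers are Lie algebras and which has an atlas of local trivializations that restrict to Lie algebra isomorphisms $\mathfrak K_p\to\mathfrak g$ on the fibers. For a finite-dimensional real Lie algebra $\mathfrak h$ let $\kappa_{\mathfrak h}\colon\mathfrak h\times\mathfrak h\to V(\mathfrak h)$ be the universal invariant symmetric bilinear form, so that $V(\mathfrak h)$ is the quotient of $\mathfrak h\otimes\mathfrak h$ by the span of all $x\otimes y-y\otimes x$ and $[x,y]\otimes z-x\otimes[y,z]$. Let $V(\mathfrak K)\to M$ be the vector bundle with fibers $V(\mathfrak K_p)$ and with the trivializations induced by those of $\mathfrak K$, and put $$\kappa_{\mathfrak K}\colon C_c^\infty(M,\mathfrak K)^2\to C_c^\infty(M,V(\mathfrak K)),\qquad \kappa_{\mathfrak K}(\xi,\eta)(p)=\kappa_{\mathfrak K_p}(\xi(p),\eta(p)),$$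 $$\tilde\kappa_{\mathfrak K}\colon \Omega_c^1(M,\mathfrak K)\times C_c^\infty(M,\mathfrak K)\to \Omega_c^1(M,V(\mathfrak K)),\qquad \tilde\kappa_{\mathfrak K}(\omega,\eta)_p(v)=\kappa_{\mathfrak K_p}(\omega_p(v),\eta(p)),$$ and $\tilde\kappa_{\mathfrak K}(\eta,\omega)=\tilde\kappa_{\mathfrak K}(\omega,\eta)$. For a vector bundle $\mathbb V\to M$, the spaces $C_c^\infty(M,\mathbb V)$ and $\Omega_c^1(M,\mathbb V)$ of compactly supported smooth sections and $\mathbb V$-valued one-forms carry the locally convex inductive limit topology over the subspaces of elements supported in a fixed compact set, each with the $C^\infty$-topology (uniform convergence on compact sets of all derivatives in local coordinates). A Koszul connection on $\mathbb V$ is an $\mathbb R$-linear map $d\colon C_c^\infty(M,\mathbb V)\to\Omega_c^1(M,\mathbb V)$ with $d(f\eta)=f\,d\eta+\eta\,df$ for all $f\in C^\infty(M,\mathbb R)$ and $\eta\in C_c^\infty(M,\mathbb V)$. A Lie connection on $\mathfrak K$ is a Koszul connection $D$ on $\mathfrak K$ with $D[\eta,\tau]=[D\eta,\tau]+[\eta,D\tau]$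 for all $\eta,\tau\in C_c^\infty(M,\mathfrak K)$. Let $D\colon C_c^\infty(M,\mathfrak K)\to\Omega_c^1(M,\mathfrak K)$ be a continuous Lie connection and let $\beta\colon C_c^\infty(M,\mathfrak K)^2\to\Omega_c^1(M,V(\mathfrak K))$, $\beta(\zeta,\eta)=\tilde\kappa_{\mathfrak K}(D\zeta,\eta)+\tilde\kappa_{\mathfrak K}(\zeta,D\eta)$. Then there exists a unique continuous Koszul connection $d\colon C_c^\infty(M,V(\mathfrak K))\to\Omega_c^1(M,V(\mathfrak K))$ such that $d\circ\kappa_{\mathfrak K}=\beta$, that is, $d(\kappa_{\mathfrak K}(\zeta,\eta))=\beta(\zeta,\eta)$ for all $\zeta,\eta\in C_c^\infty(M,\mathfrak K)$. -/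

import Mathlib

open Bundle Topology
open scoped Manifold ContDiff TensorProduct Topology

/-- A Lie ring with a norm on its underlying additive group. -/
class NormedLieRing (L : Type*) extends NormedAddCommGroup L, LieRing L

/-- A real Lie algebra whose underlying vector space is normed. For a finite-dimensional Lie algebra
the norm is auxiliary: any norm may be chosen and all of them are equivalent. -/
class NormedLieAlgebra (L : Type*) [NormedLieRing L] extends NormedSpace ℝ L, LieAlgebra ℝ L

section InvForm

variable (L : Type*) [LieRing L] [LieAlgebra ℝ L]

/-- The relations of symmetry and invariance in `L ⊗ L`. -/
def invFormRelations : Submodule ℝ (L ⊗[ℝ] L) :=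
  Submodule.span ℝ
    ({t | ∃ x y : L, t = x ⊗ₜ[ℝ] y - y ⊗ₜ[ℝ] x} ∪
      {t | ∃ x y z : L, t = ⁅x, y⁆ ⊗ₜ[ℝ] z - x ⊗ₜ[ℝ] ⁅y, z⁆})

/-- The target space `V_L` of the universal invariant symmetric bilinear form of `L`. -/
def InvForm : Type _ := (L ⊗[ℝ] L) ⧸ invFormRelations L

noncomputable instance : AddCommGroup (InvForm L) :=
  inferInstanceAs (AddCommGroup ((L ⊗[ℝ] L) ⧸ invFormRelations L))

noncomputable instance : Module ℝ (InvForm L) :=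
  inferInstanceAs (Module ℝ ((L ⊗[ℝ] L) ⧸ invFormRelations L))

/-- The quotient map `L ⊗ L → V_L`. -/
noncomputable def InvForm.proj : L ⊗[ℝ] L →ₗ[ℝ] InvForm L := (invFormRelations L).mkQ

/-- The universal invariant symmetric bilinear form `κ_L : L × L → V_L`. -/
noncomputable def InvForm.kappa : L →ₗ[ℝ] L →ₗ[ℝ] InvForm L :=
  (TensorProduct.mk ℝ L L).compr₂ (InvForm.proj L)

variable {L}

theorem InvForm.proj_surjective : Function.Surjective (InvForm.proj L) :=
  Submodule.mkQ_surjective _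

theorem InvForm.kappa_symm (x y : L) : InvForm.kappa L x y = InvForm.kappa L y x := by
  refine (Submodule.Quotient.eq _).2 (Submodule.subset_span (Or.inl ⟨x, y, rfl⟩))

theorem InvForm.kappa_invariant (x y z : L) :
    InvForm.kappa L ⁅x, y⁆ z = InvForm.kappa L x ⁅y, z⁆ := by
  refine (Submodule.Quotient.eq _).2 (Submodule.subset_span (Or.inr ⟨x, y, z, rfl⟩))

theorem InvForm.hom_ext {W : Type*} [AddCommGroup W] [Module ℝ W] {f g : InvForm L →ₗ[ℝ] W}
    (h : ∀ x y, f (InvForm.kappa L x y) = g (InvForm.kappa L x y)) : f = g := by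
  have : f ∘ₗ InvForm.proj L = g ∘ₗ InvForm.proj L := TensorProduct.ext' h
  ext v
  obtain ⟨t, rfl⟩ := InvForm.proj_surjective v
  exact LinearMap.congr_fun this t

/-- Universal property of `κ_L`: every invariant symmetric bilinear form `b` factors through `κ_L`
by a linear map, which is unique by `InvForm.hom_ext`. -/
noncomputable def InvForm.lift {W : Type*} [AddCommGroup W] [Module ℝ W] (b : L →ₗ[ℝ] L →ₗ[ℝ] W)
    (hs : ∀ x y, b x y = b y x) (hi : ∀ x y z, b ⁅x, y⁆ z = b x ⁅y, z⁆) : InvForm L →ₗ[ℝ] W :=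
  (invFormRelations L).liftQ (TensorProduct.lift b) <| by
    refine Submodule.span_le.2 ?_
    rintro t (⟨x, y, rfl⟩ | ⟨x, y, z, rfl⟩)
    · simp [hs x y]
    · simp [hi x y z]

theorem InvForm.lift_kappa {W : Type*} [AddCommGroup W] [Module ℝ W] (b : L →ₗ[ℝ] L →ₗ[ℝ] W)
    (hs : ∀ x y, b x y = b y x) (hi : ∀ x y z, b ⁅x, y⁆ z = b x ⁅y, z⁆) (x y : L) :
    InvForm.lift b hs hi (InvForm.kappa L x y) = b x y :=
  TensorProduct.lift.tmul x y

variable {L' L'' : Type*} [LieRing L'] [LieAlgebra ℝ L'] [LieRing L''] [LieAlgebra ℝ L'']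

/-- The map `f_κ : V_L → V_L'` induced by a homomorphism of Lie algebras `f : L → L'`. -/
noncomputable def InvForm.map (f : L →ₗ⁅ℝ⁆ L') : InvForm L →ₗ[ℝ] InvForm L' :=
  InvForm.lift ((InvForm.kappa L').compl₁₂ (f : L →ₗ[ℝ] L') (f : L →ₗ[ℝ] L'))
    (fun x y => InvForm.kappa_symm _ _)
    (fun x y z => by simp [InvForm.kappa_invariant])

theorem InvForm.map_kappa (f : L →ₗ⁅ℝ⁆ L') (x y : L) :
    InvForm.map f (InvForm.kappa L x y) = InvForm.kappa L' (f x) (f y) :=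
  InvForm.lift_kappa _ _ _ _ _

instance [FiniteDimensional ℝ L] : FiniteDimensional ℝ (InvForm L) :=
  inferInstanceAs (FiniteDimensional ℝ ((L ⊗[ℝ] L) ⧸ invFormRelations L))

end InvForm

section InvFormNorm

variable (𝔤 : Type*) [NormedLieRing 𝔤] [NormedLieAlgebra 𝔤] [FiniteDimensional ℝ 𝔤]

/-- A norm on the finite-dimensional space `V_𝔤`, obtained from a basis. -/
noncomputable instance : NormedAddCommGroup (InvForm 𝔤) :=
  NormedAddCommGroup.induced (InvForm 𝔤) (Fin (Module.finrank ℝ (InvForm 𝔤)) → ℝ)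
    (Module.finBasis ℝ (InvForm 𝔤)).equivFun.toLinearMap
    (Module.finBasis ℝ (InvForm 𝔤)).equivFun.injective

noncomputable instance : NormedSpace ℝ (InvForm 𝔤) :=
  NormedSpace.induced ℝ (InvForm 𝔤) (Fin (Module.finrank ℝ (InvForm 𝔤)) → ℝ)
    (Module.finBasis ℝ (InvForm 𝔤)).equivFun.toLinearMap

end InvFormNorm

section LieAlgebraBundle

variable {M : Type*} [TopologicalSpace M]

/-- A Lie algebra bundle with typical fiber `𝔤`: a vector bundle whose fibers are Lie algebras and
whose local trivializations (those of its bundle atlas) are fiberwise Lie algebra homomorphisms. -/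
class LieAlgebraBundle (𝔤 : Type*) [NormedLieRing 𝔤] [NormedLieAlgebra 𝔤] (K : M → Type*)
    [∀ x, LieRing (K x)] [∀ x, LieAlgebra ℝ (K x)] [∀ x, TopologicalSpace (K x)]
    [TopologicalSpace (TotalSpace 𝔤 K)] [FiberBundle 𝔤 K] [VectorBundle ℝ 𝔤 K] : Prop where
  map_lie : ∀ (e : Trivialization 𝔤 (Bundle.TotalSpace.proj : TotalSpace 𝔤 K → M))
    [MemTrivializationAtlas e] (x : M), x ∈ e.baseSet → ∀ u v : K x,
      (e ⟨x, ⁅u, v⁆⟩).2 = ⁅(e ⟨x, u⟩).2, (e ⟨x, v⟩).2⁆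

variable (K : M → Type*) [∀ x, LieRing (K x)] [∀ x, LieAlgebra ℝ (K x)]

/-- The fibers `V(K_x)` of the bundle `V(K)`. -/
def InvFormBundle (x : M) : Type _ := InvForm (K x)

noncomputable instance (x : M) : AddCommGroup (InvFormBundle K x) :=
  inferInstanceAs (AddCommGroup (InvForm (K x)))

noncomputable instance (x : M) : Module ℝ (InvFormBundle K x) :=
  inferInstanceAs (Module ℝ (InvForm (K x)))

/-- The fibers, finite-dimensional in all uses below, carry their vector space topology. -/
noncomputable instance (x : M) : TopologicalSpace (InvFormBundle K x) :=
  moduleTopology ℝ (InvFormBundle K x)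

instance (x : M) : IsModuleTopology ℝ (InvFormBundle K x) := ⟨rfl⟩

instance (x : M) : ContinuousSMul ℝ (InvFormBundle K x) :=
  IsModuleTopology.toContinuousSMul ℝ _

instance (x : M) : IsTopologicalAddGroup (InvFormBundle K x) :=
  IsModuleTopology.topologicalAddGroup ℝ _

variable {K}
variable {𝔤 : Type*} [NormedLieRing 𝔤] [NormedLieAlgebra 𝔤] [∀ x, TopologicalSpace (K x)]
  [TopologicalSpace (TotalSpace 𝔤 K)] [FiberBundle 𝔤 K] [VectorBundle ℝ 𝔤 K] [LieAlgebraBundle 𝔤 K]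
  (e e' : Trivialization 𝔤 (Bundle.TotalSpace.proj : TotalSpace 𝔤 K → M))
  [MemTrivializationAtlas e] [MemTrivializationAtlas e']

/-- The Lie algebra homomorphism `K_x → 𝔤` given by a trivialization (zero outside its base). -/
noncomputable def trivLieHom (x : M) : K x →ₗ⁅ℝ⁆ 𝔤 :=
  { e.linearMapAt ℝ x with
    map_lie' := by
      intro u v
      by_cases hx : x ∈ e.baseSet
      · have := LieAlgebraBundle.map_lie e x hx u v
        simpa [Trivialization.linearMapAt_apply, hx] using this
      · simp [Trivialization.linearMapAt_apply, hx] }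

theorem trivLieHom_apply {x : M} (hx : x ∈ e.baseSet) (u : K x) :
    trivLieHom e x u = (e ⟨x, u⟩).2 :=
  congrFun (e.coe_linearMapAt_of_mem (R := ℝ) hx) u

/-- The Lie algebra homomorphism `𝔤 → K_x` inverse to `trivLieHom e x` over the base set. -/
noncomputable def trivSymmLieHom (x : M) : 𝔤 →ₗ⁅ℝ⁆ K x :=
  { e.symmₗ ℝ x with
    map_lie' := by
      intro u v
      by_cases hx : x ∈ e.baseSet
      · have h := (trivLieHom e x).map_lie (e.symmₗ ℝ x u) (e.symmₗ ℝ x v)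
        have h2 : ∀ w, trivLieHom e x (e.symmₗ ℝ x w) = w := fun w =>
          e.linearMapAt_symmₗ (R := ℝ) hx w
        rw [h2, h2] at h
        have h3 := congrArg (e.symmₗ ℝ x) h
        exact (h3.symm.trans (e.symmₗ_linearMapAt (R := ℝ) hx _))
      · have h0 : ∀ w, e.symmₗ ℝ x w = 0 := fun w => by
          exact e.symmₗ_apply_of_notMem (R := ℝ) hx w
        change e.symmₗ ℝ x ⁅u, v⁆ = ⁅e.symmₗ ℝ x u, e.symmₗ ℝ x v⁆
        rw [h0, h0, h0, lie_zero] }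

theorem trivLieHom_symm {x : M} (hx : x ∈ e.baseSet) (w : 𝔤) :
    trivLieHom e x (trivSymmLieHom e x w) = w :=
  e.linearMapAt_symmₗ (R := ℝ) hx w

theorem trivSymmLieHom_triv {x : M} (hx : x ∈ e.baseSet) (w : K x) :
    trivSymmLieHom e x (trivLieHom e x w) = w :=
  e.symmₗ_linearMapAt (R := ℝ) hx w

theorem InvForm.map_triv_symm {x : M} (hx : x ∈ e.baseSet) (w : InvForm 𝔤) :
    InvForm.map (trivLieHom e x) (InvForm.map (trivSymmLieHom e x) w) = w := by
  have : InvForm.map (trivLieHom e x) ∘ₗ InvForm.map (trivSymmLieHom e x) = LinearMap.id :=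
    InvForm.hom_ext fun u v => by simp [InvForm.map_kappa, trivLieHom_symm e hx]
  exact LinearMap.congr_fun this w

theorem InvForm.map_symm_triv {x : M} (hx : x ∈ e.baseSet) (w : InvForm (K x)) :
    InvForm.map (trivSymmLieHom e x) (InvForm.map (trivLieHom e x) w) = w := by
  have : InvForm.map (trivSymmLieHom e x) ∘ₗ InvForm.map (trivLieHom e x) = LinearMap.id :=
    InvForm.hom_ext fun u v => by simp [InvForm.map_kappa, trivSymmLieHom_triv e hx]
  exact LinearMap.congr_fun this w

/-- The map `V(K_x) → V_𝔤` given by a trivialization. -/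
noncomputable def invFormTriv (x : M) : InvFormBundle K x →ₗ[ℝ] InvForm 𝔤 :=
  InvForm.map (trivLieHom e x)

/-- The map `V_𝔤 → V(K_x)` given by the inverse of a trivialization. -/
noncomputable def invFormTrivSymm (x : M) : InvForm 𝔤 →ₗ[ℝ] InvFormBundle K x :=
  InvForm.map (trivSymmLieHom e x)

variable [FiniteDimensional ℝ 𝔤]

/-- The trivialization of `V(K)` that comes from a trivialization `e` of `K`:
`v ∈ V(K_x)` is mapped to `(x, (e_x)_κ v)`. -/
noncomputable def invFormPretrivialization :
    Pretrivialization (InvForm 𝔤)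
      (Bundle.TotalSpace.proj : TotalSpace (InvForm 𝔤) (InvFormBundle K) → M) where
  toFun p := (p.1, invFormTriv e p.1 p.2)
  invFun p := ⟨p.1, invFormTrivSymm e p.1 p.2⟩
  source := Bundle.TotalSpace.proj ⁻¹' e.baseSet
  target := e.baseSet ×ˢ Set.univ
  map_source' := fun _ h => ⟨h, Set.mem_univ _⟩
  map_target' := fun _ h => h.1
  left_inv' := fun ⟨x, v⟩ h => by
    have := InvForm.map_symm_triv e h v
    exact congrArg (TotalSpace.mk x) this
  right_inv' := fun ⟨x, v⟩ h => by
    have := InvForm.map_triv_symm e h.1 v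
    simp only [Prod.mk_right_inj]
    exact this
  open_target := e.open_baseSet.prod isOpen_univ
  baseSet := e.baseSet
  open_baseSet := e.open_baseSet
  source_eq := rfl
  target_eq := rfl
  proj_toFun _ _ := rfl

instance : (invFormPretrivialization e).IsLinear ℝ where
  linear x _ := (invFormTriv e x).isLinear

/-- For linear `A, B : 𝔤 → 𝔤`, the composite `V_𝔤 → 𝔤 ⊗ 𝔤 → 𝔤 ⊗ 𝔤 → V_𝔤` of a fixed linear section
of the projection, `A ⊗ B`, and the projection, as a continuous bilinear map in `(A, B)`. -/
noncomputable def invFormEndo (𝔤 : Type*) [NormedLieRing 𝔤] [NormedLieAlgebra 𝔤]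
    [FiniteDimensional ℝ 𝔤] :
    (𝔤 →L[ℝ] 𝔤) →L[ℝ] (𝔤 →L[ℝ] 𝔤) →L[ℝ] (InvForm 𝔤 →L[ℝ] InvForm 𝔤) :=
  LinearMap.toContinuousLinearMap <| LinearMap.toContinuousLinearMap.toLinearMap ∘ₗ
    LinearMap.mk₂ ℝ
    (fun A B => LinearMap.toContinuousLinearMap
      (InvForm.proj 𝔤 ∘ₗ TensorProduct.map (A : 𝔤 →ₗ[ℝ] 𝔤) (B : 𝔤 →ₗ[ℝ] 𝔤) ∘ₗ
        (LinearMap.exists_rightInverse_of_surjective (InvForm.proj 𝔤)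
          (LinearMap.range_eq_top.2 InvForm.proj_surjective)).choose))
    (fun A A' B => by ext; simp [TensorProduct.map_add_left])
    (fun c A B => by ext; simp [TensorProduct.map_smul_left])
    (fun A B B' => by ext; simp [TensorProduct.map_add_right])
    (fun c A B => by ext; simp [TensorProduct.map_smul_right])

theorem invFormEndo_apply (A : 𝔤 →L[ℝ] 𝔤) (f : 𝔤 →ₗ⁅ℝ⁆ 𝔤) (h : ∀ x, A x = f x) (w : InvForm 𝔤) :
    invFormEndo 𝔤 A A w = InvForm.map f w := by
  set s := (LinearMap.exists_rightInverse_of_surjective (InvForm.proj 𝔤)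
          (LinearMap.range_eq_top.2 InvForm.proj_surjective)).choose with hs
  have hs' : InvForm.proj 𝔤 ∘ₗ s = LinearMap.id :=
    (LinearMap.exists_rightInverse_of_surjective (InvForm.proj 𝔤)
          (LinearMap.range_eq_top.2 InvForm.proj_surjective)).choose_spec
  have key : InvForm.proj 𝔤 ∘ₗ TensorProduct.map (A : 𝔤 →ₗ[ℝ] 𝔤) (A : 𝔤 →ₗ[ℝ] 𝔤)
      = InvForm.map f ∘ₗ InvForm.proj 𝔤 := by
    refine TensorProduct.ext' fun x y => ?_
    have := InvForm.map_kappa f x y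
    simp only [LinearMap.comp_apply, TensorProduct.map_tmul]
    refine Eq.trans ?_ this.symm
    simp [InvForm.kappa, h]
  have h1 : invFormEndo 𝔤 A A w
      = (InvForm.proj 𝔤 ∘ₗ TensorProduct.map (A : 𝔤 →ₗ[ℝ] 𝔤) (A : 𝔤 →ₗ[ℝ] 𝔤)) (s w) := rfl
  rw [h1, key]
  exact congrArg (InvForm.map f) (LinearMap.congr_fun hs' w)

theorem invFormPretrivialization_coordChange {x : M} (hx : x ∈ e.baseSet ∩ e'.baseSet)
    (v : InvForm 𝔤) :
    invFormEndo 𝔤 (e.coordChangeL ℝ e' x) (e.coordChangeL ℝ e' x) v =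
      (invFormPretrivialization e' ⟨x, (invFormPretrivialization e).symm x v⟩).2 := by
  have h1 : (invFormPretrivialization e).symm x v = InvForm.map (trivSymmLieHom e x) v := by
    rw [Pretrivialization.symm_apply _ hx.1]; rfl
  rw [h1, invFormEndo_apply _ ((trivLieHom e' x).comp (trivSymmLieHom e x))]
  · have : InvForm.map ((trivLieHom e' x).comp (trivSymmLieHom e x)) =
        InvForm.map (trivLieHom e' x) ∘ₗ InvForm.map (trivSymmLieHom e x) :=
      InvForm.hom_ext fun u v => by simp [InvForm.map_kappa]
    rw [this]; rfl
  · intro w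
    rw [ContinuousLinearEquiv.coe_coe, Trivialization.coordChangeL_apply _ _ hx]
    rw [← trivLieHom_apply e' hx.2]
    exact congrArg (trivLieHom e' x) (congrFun (e.coe_symmₗ (R := ℝ) hx.1).symm w)

variable (K 𝔤)

/-- The vector bundle `V(K)`, given by the trivializations that come from those of `K`. -/
noncomputable def invFormPrebundle : VectorPrebundle ℝ (InvForm 𝔤) (InvFormBundle K) where
  pretrivializationAtlas :=
    {t | ∃ (e : Trivialization 𝔤 (Bundle.TotalSpace.proj : TotalSpace 𝔤 K → M))
      (_ : MemTrivializationAtlas e), t = invFormPretrivialization e}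
  pretrivialization_linear' := by
    rintro _ ⟨e, he, rfl⟩
    infer_instance
  pretrivializationAt x := invFormPretrivialization (trivializationAt 𝔤 K x)
  mem_base_pretrivializationAt x := FiberBundle.mem_baseSet_trivializationAt 𝔤 K x
  pretrivialization_mem_atlas x := ⟨trivializationAt 𝔤 K x, inferInstance, rfl⟩
  exists_coordChange := by
    rintro _ ⟨e, he, rfl⟩ _ ⟨e', he', rfl⟩
    refine ⟨fun x => invFormEndo 𝔤 (e.coordChangeL ℝ e' x) (e.coordChangeL ℝ e' x), ?_,
      fun x hx v => invFormPretrivialization_coordChange e e' hx v⟩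
    have h := continuousOn_coordChange ℝ e e'
    exact ((invFormEndo 𝔤).continuous.comp_continuousOn h).clm_apply h
  totalSpaceMk_isInducing := by
    intro x
    have hx := FiberBundle.mem_baseSet_trivializationAt 𝔤 K x
    set e := trivializationAt 𝔤 K x
    have h1 : Continuous (invFormTriv e x) := IsModuleTopology.continuous_of_linearMap _
    have h2 : Continuous (invFormTrivSymm e x) := LinearMap.continuous_of_finiteDimensional _
    have : IsInducing fun v : InvFormBundle K x => (x, invFormTriv e x v) :=
      Topology.isInducing_const_prod.mpr
        (Homeomorph.isInducing
          { toFun := invFormTriv e x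
            invFun := invFormTrivSymm e x
            left_inv := fun v => InvForm.map_symm_triv e hx v
            right_inv := fun v => InvForm.map_triv_symm e hx v
            continuous_toFun := h1
            continuous_invFun := h2 })
    exact this

noncomputable instance : TopologicalSpace (TotalSpace (InvForm 𝔤) (InvFormBundle K)) :=
  (invFormPrebundle K 𝔤).totalSpaceTopology

noncomputable instance : FiberBundle (InvForm 𝔤) (InvFormBundle K) :=
  (invFormPrebundle K 𝔤).toFiberBundle

instance : VectorBundle ℝ (InvForm 𝔤) (InvFormBundle K) :=
  (invFormPrebundle K 𝔤).toVectorBundle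

variable {E : Type*} [NormedAddCommGroup E] [NormedSpace ℝ E] [ChartedSpace E M]
  [ContMDiffVectorBundle ∞ 𝔤 K 𝓘(ℝ, E)]

set_option synthInstance.maxHeartbeats 200000 in
instance : (invFormPrebundle K 𝔤).IsContMDiff 𝓘(ℝ, E) ∞ where
  exists_contMDiffCoordChange := by
    rintro _ ⟨e, he, rfl⟩ _ ⟨e', he', rfl⟩
    refine ⟨fun x => invFormEndo 𝔤 (e.coordChangeL ℝ e' x) (e.coordChangeL ℝ e' x), ?_,
      fun x hx v => invFormPretrivialization_coordChange e e' hx v⟩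
    have h := contMDiffOn_coordChangeL (IB := 𝓘(ℝ, E)) (n := ∞) e e'
    exact ((invFormEndo 𝔤).contMDiff.comp_contMDiffOn h).clm_apply h

instance : ContMDiffVectorBundle ∞ (InvForm 𝔤) (InvFormBundle K) 𝓘(ℝ, E) :=
  (invFormPrebundle K 𝔤).contMDiffVectorBundle 𝓘(ℝ, E)

end LieAlgebraBundle

section Sections

variable (E : Type*) [NormedAddCommGroup E] [NormedSpace ℝ E]
  {M : Type*} [TopologicalSpace M] [ChartedSpace E M]
  (F : Type*) [NormedAddCommGroup F] [NormedSpace ℝ F]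
  (V : M → Type*) [TopologicalSpace (TotalSpace F V)] [∀ x, AddCommGroup (V x)]
  [∀ x, TopologicalSpace (V x)] [FiberBundle F V]

/-- The topology of `C^∞(M, V)`: the coarsest one for which, for every bundle trivialization `e`,
every chart `c` of `M` and every `k`, the `k`-th derivative of the local representative of a section
with respect to `e` and `c` depends continuously on the section, for uniform convergence on compact
subsets of the domain of that local representative. -/
@[reducible]
noncomputable def smoothSectionTopology : TopologicalSpace Cₛ^∞⟮𝓘(ℝ, E); F, V⟯ :=
  ⨅ (e : Trivialization F (Bundle.TotalSpace.proj : TotalSpace F V → M))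
    (_ : MemTrivializationAtlas e) (c : OpenPartialHomeomorph M E) (_ : c ∈ atlas E M) (k : ℕ),
    TopologicalSpace.induced
      (fun s => UniformOnFun.ofFun {A : Set E | IsCompact A ∧ A ⊆ c.target ∩ c.symm ⁻¹' e.baseSet}
        (iteratedFDeriv ℝ k fun y : E => (e ⟨c.symm y, s (c.symm y)⟩).2))
      inferInstance

variable {E F V} in
/-- The support of a section. -/
def sectionSupport (s : Cₛ^∞⟮𝓘(ℝ, E); F, V⟯) : Set M := closure {x | s x ≠ 0}

/-- The elements of `C_c^∞(M, V)`, as a type of its own, which carries the inductive limit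
topology. -/
structure CompactSection where
  toSection : Cₛ^∞⟮𝓘(ℝ, E); F, V⟯
  isCompact_support : IsCompact (sectionSupport toSection)

noncomputable instance : CoeFun (CompactSection E F V) (fun _ => ∀ x, V x) := ⟨fun s => s.toSection⟩

variable {E F V} in
theorem CompactSection.ext {s t : CompactSection E F V} (h : ∀ x, s x = t x) : s = t := by
  obtain ⟨s, hs⟩ := s
  obtain ⟨t, ht⟩ := t
  obtain rfl : s = t := ContMDiffSection.ext h
  rfl

variable [∀ x, Module ℝ (V x)] [VectorBundle ℝ F V]

section support
variable {E F V}

theorem sectionSupport_zero : sectionSupport (0 : Cₛ^∞⟮𝓘(ℝ, E); F, V⟯) = ∅ := by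
  simp [sectionSupport]

theorem sectionSupport_add (s t : Cₛ^∞⟮𝓘(ℝ, E); F, V⟯) :
    sectionSupport (s + t) ⊆ sectionSupport s ∪ sectionSupport t := by
  unfold sectionSupport
  rw [← closure_union]
  refine closure_mono fun x hx => ?_
  by_contra h
  simp only [Set.mem_union, Set.mem_ofPred_eq, not_or, not_not] at h
  exact hx (by simp [h.1, h.2])

theorem sectionSupport_smul (a : ℝ) (s : Cₛ^∞⟮𝓘(ℝ, E); F, V⟯) :
    sectionSupport (a • s) ⊆ sectionSupport s := by
  refine closure_mono fun x hx h => hx ?_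
  have h' : s x = 0 := h
  simp [h']

end support

/-- The space `C_A^∞(M, V)` of smooth sections with support in a given compact set `A`. -/
def sectionsSupportedIn (A : TopologicalSpace.Compacts M) :
    Submodule ℝ Cₛ^∞⟮𝓘(ℝ, E); F, V⟯ where
  carrier := {s | sectionSupport s ⊆ A}
  zero_mem' := by simp [sectionSupport_zero]
  add_mem' hs ht := (sectionSupport_add _ _).trans (Set.union_subset hs ht)
  smul_mem' a _ hs := (sectionSupport_smul a _).trans hs

/-- The subspace `C_c^∞(M, V)` of smooth sections with compact support. -/
def compactlySupportedSections : Submodule ℝ Cₛ^∞⟮𝓘(ℝ, E); F, V⟯ where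
  carrier := {s | IsCompact (sectionSupport s)}
  zero_mem' := by simp [sectionSupport_zero]
  add_mem' hs ht := (hs.union ht).of_isClosed_subset isClosed_closure (sectionSupport_add _ _)
  smul_mem' a _ hs := hs.of_isClosed_subset isClosed_closure (sectionSupport_smul a _)

/-- The identification of the type `CompactSection E F V` with the submodule `C_c^∞(M, V)`. -/
def CompactSection.equiv : CompactSection E F V ≃ compactlySupportedSections E F V where
  toFun s := ⟨s.1, s.2⟩
  invFun s := ⟨s.1, s.2⟩

noncomputable instance : AddCommGroup (CompactSection E F V) :=
  (CompactSection.equiv E F V).addCommGroup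

noncomputable instance : Module ℝ (CompactSection E F V) :=
  (CompactSection.equiv E F V).module ℝ

variable {E F V} in
theorem CompactSection.add_apply (s t : CompactSection E F V) (x : M) : (s + t) x = s x + t x := rfl

variable {E F V} in
theorem CompactSection.smul_apply (a : ℝ) (s : CompactSection E F V) (x : M) :
    (a • s) x = a • s x := rfl

/-- The inclusion `C_A^∞(M, V) → C_c^∞(M, V)`. -/
noncomputable def CompactSection.ofSupportedIn (A : TopologicalSpace.Compacts M)
    (s : sectionsSupportedIn E F V A) : CompactSection E F V :=
  ⟨s.1, A.isCompact.of_isClosed_subset isClosed_closure s.2⟩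

/-- The topology of `C_c^∞(M, V)` as the inductive limit of the spaces `C_A^∞(M, V)`, `A` compact,
in the category of locally convex spaces: the finest locally convex vector space topology for which
all inclusions `C_A^∞(M, V) → C_c^∞(M, V)` are continuous. -/
noncomputable instance : TopologicalSpace (CompactSection E F V) :=
  sInf {t : TopologicalSpace (CompactSection E F V) |
    (∀ A : TopologicalSpace.Compacts M,
      @Continuous _ _ (TopologicalSpace.induced Subtype.val (smoothSectionTopology E F V)) t
        (CompactSection.ofSupportedIn E F V A)) ∧
    @IsTopologicalAddGroup (CompactSection E F V) t _ ∧
    @ContinuousSMul ℝ (CompactSection E F V) _ _ t ∧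
    @LocallyConvexSpace ℝ (CompactSection E F V) _ _ _ _ t}

instance : IsTopologicalAddGroup (CompactSection E F V) :=
  topologicalAddGroup_sInf fun _ ⟨_, ht, _, _⟩ => ht

instance : ContinuousSMul ℝ (CompactSection E F V) :=
  continuousSMul_sInf fun _ ⟨_, _, ht, _⟩ => ht

instance : LocallyConvexSpace ℝ (CompactSection E F V) :=
  .sInf fun _ ⟨_, _, _, ht⟩ => ht

/-- The product `f • η` of a smooth function and a compactly supported section. -/
noncomputable instance : SMul C^∞⟮𝓘(ℝ, E), M; ℝ⟯ (CompactSection E F V) where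
  smul f s := ⟨⟨fun x => f x • s x, f.contMDiff.smul_section s.1.contMDiff⟩,
    s.2.of_isClosed_subset isClosed_closure <| closure_mono fun x hx h => hx (by
      have h' : s x = 0 := h
      simp [h'])⟩

variable [IsManifold 𝓘(ℝ, E) ∞ M] [∀ x, IsTopologicalAddGroup (V x)] [∀ x, ContinuousSMul ℝ (V x)]

/-- The space `Ω_c^1(M, V)` of compactly supported smooth `V`-valued one-forms, i.e. of compactly
supported smooth sections of the bundle of linear maps from `TM` to `V`. -/
abbrev CompactOneForm : Type _ :=
  CompactSection E (E →L[ℝ] F) (fun x : M => TangentSpace 𝓘(ℝ, E) x →L[ℝ] V x)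

variable {E F V}

/-- Koszul connections: linear maps `d : C_c^∞(M, V) → Ω_c^1(M, V)` with
`d (f • η) = f • d η + df • η`. -/
def IsKoszulConnection (d : CompactSection E F V →ₗ[ℝ] CompactOneForm E F V) : Prop :=
  ∀ (f : C^∞⟮𝓘(ℝ, E), M; ℝ⟯) (η : CompactSection E F V) (x : M) (v : TangentSpace 𝓘(ℝ, E) x),
    d (f • η) x v = f x • d η x v + mvfderiv 𝓘(ℝ, E) f x v • η x

end Sections

section LieSections

variable {E : Type*} [NormedAddCommGroup E] [NormedSpace ℝ E] [FiniteDimensional ℝ E]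
  {M : Type*} [TopologicalSpace M] [ChartedSpace E M]
  {𝔤 : Type*} [NormedLieRing 𝔤] [NormedLieAlgebra 𝔤] [FiniteDimensional ℝ 𝔤]
  {K : M → Type*} [∀ x, LieRing (K x)] [∀ x, LieAlgebra ℝ (K x)] [∀ x, TopologicalSpace (K x)]
  [TopologicalSpace (TotalSpace 𝔤 K)] [FiberBundle 𝔤 K] [VectorBundle ℝ 𝔤 K]
  [LieAlgebraBundle 𝔤 K]

/-- The Lie bracket of `𝔤` as a continuous bilinear map. -/
noncomputable def bracketCLM (𝔤 : Type*) [NormedLieRing 𝔤] [NormedLieAlgebra 𝔤]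
    [FiniteDimensional ℝ 𝔤] : 𝔤 →L[ℝ] 𝔤 →L[ℝ] 𝔤 :=
  LinearMap.toContinuousLinearMap <| LinearMap.toContinuousLinearMap.toLinearMap ∘ₗ
    LinearMap.mk₂ ℝ (fun x y : 𝔤 => ⁅x, y⁆) add_lie smul_lie lie_add lie_smul

/-- The form `κ_𝔤` as a continuous bilinear map. -/
noncomputable def kappaCLM (𝔤 : Type*) [NormedLieRing 𝔤] [NormedLieAlgebra 𝔤]
    [FiniteDimensional ℝ 𝔤] : 𝔤 →L[ℝ] 𝔤 →L[ℝ] InvForm 𝔤 :=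
  LinearMap.toContinuousLinearMap <| LinearMap.toContinuousLinearMap.toLinearMap ∘ₗ
    InvForm.kappa 𝔤

/-- The bracket of compactly supported sections, `⁅η, τ⁆(x) = ⁅η(x), τ(x)⁆`. -/
noncomputable instance : Bracket (CompactSection E 𝔤 K) (CompactSection E 𝔤 K) where
  bracket η τ := ⟨⟨fun x => ⁅η x, τ x⁆, fun x₀ => by
      have h₁ := (contMDiffAt_section x₀).1 (η.1.contMDiff x₀)
      have h₂ := (contMDiffAt_section x₀).1 (τ.1.contMDiff x₀)
      refine (contMDiffAt_section x₀).2 ?_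
      refine (((bracketCLM 𝔤).contMDiff.contMDiffAt.comp x₀ h₁).clm_apply
        h₂).congr_of_eventuallyEq ?_
      filter_upwards [(trivializationAt 𝔤 K x₀).open_baseSet.mem_nhds
        (FiberBundle.mem_baseSet_trivializationAt' x₀)] with x hx
      exact LieAlgebraBundle.map_lie _ x hx _ _⟩,
    η.2.of_isClosed_subset isClosed_closure <| closure_mono fun x hx h => hx (by
      have h' : η x = 0 := h
      change ⁅η x, τ x⁆ = 0
      rw [h', zero_lie])⟩

/-- The form `κ_x : K_x × K_x → V(K_x)`. -/
noncomputable def kappaFiber (K : M → Type*) [∀ x, LieRing (K x)] [∀ x, LieAlgebra ℝ (K x)]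
    (x : M) : K x →ₗ[ℝ] K x →ₗ[ℝ] InvFormBundle K x :=
  InvForm.kappa (K x)

theorem trivializationAt_kappaFiber (x₀ : M) {x : M} (hx : x ∈ (trivializationAt 𝔤 K x₀).baseSet)
    (u w : K x) :
    (trivializationAt (InvForm 𝔤) (InvFormBundle K) x₀ ⟨x, kappaFiber K x u w⟩).2 =
      kappaCLM 𝔤 (trivializationAt 𝔤 K x₀ ⟨x, u⟩).2 (trivializationAt 𝔤 K x₀ ⟨x, w⟩).2 := by
  refine (InvForm.map_kappa (trivLieHom (trivializationAt 𝔤 K x₀) x) u w).trans ?_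
  rw [trivLieHom_apply _ hx, trivLieHom_apply _ hx]
  rfl

/-- The form `κ_K : C_c^∞(M, K) × C_c^∞(M, K) → C_c^∞(M, V(K))`,
`κ_K(ξ, η)(x) = κ_x(ξ(x), η(x))`. -/
noncomputable def kappaSection (ξ η : CompactSection E 𝔤 K) :
    CompactSection E (InvForm 𝔤) (InvFormBundle K) :=
  ⟨⟨fun x => kappaFiber K x (ξ x) (η x), fun x₀ => by
      have h₁ := (contMDiffAt_section x₀).1 (ξ.1.contMDiff x₀)
      have h₂ := (contMDiffAt_section x₀).1 (η.1.contMDiff x₀)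
      refine (contMDiffAt_section x₀).2 ?_
      refine (((kappaCLM 𝔤).contMDiff.contMDiffAt.comp x₀ h₁).clm_apply
        h₂).congr_of_eventuallyEq ?_
      filter_upwards [(trivializationAt 𝔤 K x₀).open_baseSet.mem_nhds
        (FiberBundle.mem_baseSet_trivializationAt' x₀)] with x hx
      exact trivializationAt_kappaFiber x₀ hx _ _⟩,
    ξ.2.of_isClosed_subset isClosed_closure <| closure_mono fun x hx h => hx (by
      have h' : ξ x = 0 := h
      change kappaFiber K x (ξ x) (η x) = 0
      rw [h', LinearMap.map_zero₂])⟩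

variable [IsManifold 𝓘(ℝ, E) ∞ M] [∀ x, IsTopologicalAddGroup (K x)] [∀ x, ContinuousSMul ℝ (K x)]

instance (x : M) : FiniteDimensional ℝ (TangentSpace 𝓘(ℝ, E) x) :=
  inferInstanceAs (FiniteDimensional ℝ E)

instance (x : M) : T2Space (TangentSpace 𝓘(ℝ, E) x) := inferInstanceAs (T2Space E)

/-- The linear map `T_x M → V(K_x)`, `v ↦ κ_x(α(v), u)`. -/
noncomputable def kappaTangent (x : M) (α : TangentSpace 𝓘(ℝ, E) x →L[ℝ] K x) (u : K x) :
    TangentSpace 𝓘(ℝ, E) x →L[ℝ] InvFormBundle K x :=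
  LinearMap.toContinuousLinearMap ((kappaFiber K x).flip u ∘ₗ (α : TangentSpace 𝓘(ℝ, E) x →ₗ[ℝ] K x))

/-- The form `κ̃_K : Ω_c^1(M, K) × C_c^∞(M, K) → Ω_c^1(M, V(K))`,
`κ̃_K(α, η)_x(v) = κ_x(α_x(v), η(x))`. -/
noncomputable def kappaOneForm (α : CompactOneForm E 𝔤 K) (η : CompactSection E 𝔤 K) :
    CompactOneForm E (InvForm 𝔤) (InvFormBundle K) :=
  ⟨⟨fun x => kappaTangent x (α x) (η x), fun x₀ => by
      have h₁ := (contMDiffAt_section x₀).1 (α.1.contMDiff x₀)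
      have h₂ := (contMDiffAt_section x₀).1 (η.1.contMDiff x₀)
      refine (contMDiffAt_section x₀).2 ?_
      refine (((kappaCLM 𝔤).flip.contMDiff.contMDiffAt.comp x₀ h₂).clm_comp
        h₁).congr_of_eventuallyEq ?_
      filter_upwards [(trivializationAt 𝔤 K x₀).open_baseSet.mem_nhds
        (FiberBundle.mem_baseSet_trivializationAt' x₀)] with x hx
      ext v
      have hV : ∀ w : InvFormBundle K x,
          (trivializationAt (InvForm 𝔤) (InvFormBundle K) x₀).continuousLinearMapAt ℝ x w =
            (trivializationAt (InvForm 𝔤) (InvFormBundle K) x₀ ⟨x, w⟩).2 := fun w =>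
        congrFun ((trivializationAt (InvForm 𝔤) (InvFormBundle K) x₀).coe_linearMapAt_of_mem
          (R := ℝ) hx) w
      have hK : ∀ w : K x, (trivializationAt 𝔤 K x₀).continuousLinearMapAt ℝ x w =
            (trivializationAt 𝔤 K x₀ ⟨x, w⟩).2 := fun w =>
        congrFun ((trivializationAt 𝔤 K x₀).coe_linearMapAt_of_mem (R := ℝ) hx) w
      refine (hV _).trans ((trivializationAt_kappaFiber x₀ hx _ _).trans ?_)
      rw [← hK]
      rfl⟩,
    η.2.of_isClosed_subset isClosed_closure <| closure_mono fun x hx h => hx (by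
      have h' : η x = 0 := h
      ext v
      simp [h', kappaTangent])⟩

theorem kappaOneForm_apply (α : CompactOneForm E 𝔤 K) (η : CompactSection E 𝔤 K) (x : M)
    (v : TangentSpace 𝓘(ℝ, E) x) :
    kappaOneForm α η x v = kappaFiber K x (α x v) (η x) := rfl

/-- Lie connections: Koszul connections `D` on `K` with `D⁅η, τ⁆ = ⁅Dη, τ⁆ + ⁅η, Dτ⁆`. -/
def IsLieConnection (D : CompactSection E 𝔤 K →ₗ[ℝ] CompactOneForm E 𝔤 K) : Prop :=
  IsKoszulConnection D ∧
    ∀ (η τ : CompactSection E 𝔤 K) (x : M) (v : TangentSpace 𝓘(ℝ, E) x),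
      D ⁅η, τ⁆ x v = ⁅D η x v, τ x⁆ + ⁅η x, D τ x v⁆

/-- The form `β(ζ, η) = κ̃_K(Dζ, η) + κ̃_K(ζ, Dη)`, where `κ̃_K(ζ, α) = κ̃_K(α, ζ)`. -/
noncomputable def betaForm (D : CompactSection E 𝔤 K →ₗ[ℝ] CompactOneForm E 𝔤 K)
    (ζ η : CompactSection E 𝔤 K) : CompactOneForm E (InvForm 𝔤) (InvFormBundle K) :=
  kappaOneForm (D ζ) η + kappaOneForm (D η) ζ

end LieSections

/-! ### Uniform convergence of derivatives on compact sets. -/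

section UniformConvergence

open Filter

/-! The point is that `β(ζ, η)` depends only on the section `κ(ζ, η)`, linearly, and that sections
of the form `κ(ζ, η)` span `C_c^∞(M, V(K))`.

Dependence on `κ` alone: in a trivialization of `K` a Koszul connection, evaluated at a tangent
vector `v`, is the derivative along `v` plus a linear map `δ` of the fiber, and for a Lie connection
`δ` is a derivation of `𝔤` (`IsLieConnection.exists_derivation`). Hence `κ(δ u, w) + κ(u, δ w)` is
again symmetric and invariant in `(u, w)`, so it equals `T (κ(u, w))` for a linear endomorphism `T`
of `V_𝔤` (`InvForm.exists_map_of_derivation`). By the product rule, `β(ζ, η)` is locally the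
derivative of `κ(ζ, η)` plus `T` applied to it. This expression is linear in the section `κ(ζ, η)`,
so `∑ κ(ζᵢ, ηᵢ) = 0` forces `∑ β(ζᵢ, ηᵢ) = 0` (`IsLieConnection.ker_kappaSectionLift_le`), and `β`
factors through `κ`.

Spanning: a linear section of `𝔤 ⊗ 𝔤 → V_𝔤` and a partition of unity give, for each compact `A`,
finitely many bundle homomorphisms `Φᵢ : V(K) → K` and fixed sections `εᵢ` with `σ = ∑ κ(Φᵢ σ, εᵢ)`
whenever `σ` is supported in `A` (`exists_sum_kappaSection`). Uniqueness of `d` follows at once. So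
does continuity: on `C_A^∞` one has `d σ = ∑ β(Φᵢ σ, εᵢ)`, where each `Φᵢ` acts continuously on
sections and `β(·, εᵢ)` is continuous because `D` is. The Leibniz rule for `d` comes from that of
`D`, since `f • κ(ζ, η) = κ(f • ζ, η)`. -/

theorem tendstoUniformlyOn_iteratedFDeriv_clm_apply {ι E F F' : Type*}
    [NormedAddCommGroup E] [NormedSpace ℝ E] [NormedAddCommGroup F] [NormedSpace ℝ F]
    [NormedAddCommGroup F'] [NormedSpace ℝ F'] {U A : Set E} (hU : IsOpen U) (hA : IsCompact A)
    (hAU : A ⊆ U) {φ : E → F →L[ℝ] F'} (hφ : ContDiffOn ℝ ∞ φ U) {l : Filter ι} {u : ι → E → F}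
    {u₀ : E → F} (hu : ∀ j, ContDiffOn ℝ ∞ (u j) U) (hu₀ : ContDiffOn ℝ ∞ u₀ U) (k : ℕ)
    (h : ∀ i, TendstoUniformlyOn (fun j => iteratedFDeriv ℝ i (u j)) (iteratedFDeriv ℝ i u₀) l A) :
    TendstoUniformlyOn (fun j => iteratedFDeriv ℝ k fun y => φ y (u j y))
      (iteratedFDeriv ℝ k fun y => φ y (u₀ y)) l A := by
  have hb : ∀ i, ∃ C, ∀ y ∈ A, ‖iteratedFDeriv ℝ i φ y‖ ≤ C := fun i =>
    hA.exists_bound_of_continuousOn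
      ((ContinuousOn.continuousOn_iteratedFDeriv hφ hU (mod_cast le_top)).mono hAU)
  -- The absolute values are needed because the bounds `C i` may be negative when `A` is empty;
  -- dividing `ε` by `S + 1` rather than `S` covers `S = 0`.
  choose C hC using hb
  set S : ℝ := ∑ i ∈ Finset.range (k + 1), (k.choose i : ℝ) * |C i| with hS
  have hS0 : 0 ≤ S := Finset.sum_nonneg fun i _ => by positivity
  rw [Metric.tendstoUniformlyOn_iff]
  intro ε hε
  have hev : ∀ᶠ j in l, ∀ i ∈ Finset.range (k + 1), ∀ y ∈ A,
      dist (iteratedFDeriv ℝ (k - i) u₀ y) (iteratedFDeriv ℝ (k - i) (u j) y) < ε / (S + 1) :=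
    (Filter.eventually_all_finset _).2 fun i _ =>
      Metric.tendstoUniformlyOn_iff.1 (h (k - i)) _ (by positivity)
  filter_upwards [hev] with j hj y hy
  have hyU := hAU hy
  have hyn := hU.mem_nhds hyU
  have hle : ∀ i : ℕ, (i : ℕ∞ω) ≤ ∞ := fun i => mod_cast le_top
  rw [dist_eq_norm, ← fun_iteratedFDeriv_sub_apply
    (((hφ.clm_apply hu₀).contDiffAt hyn).of_le (hle k))
    (((hφ.clm_apply (hu j)).contDiffAt hyn).of_le (hle k))]
  -- By linearity of `φ y` the difference is again of product form, so the Leibniz bound involves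
  -- only derivatives of `φ`, bounded on `A`, and of `u₀ - u j`, which are small there.
  have heq : (fun y => φ y (u₀ y) - φ y (u j y)) = fun y => φ y ((u₀ - u j) y) := by
    ext y; simp
  rw [heq, ← iteratedFDerivWithin_of_isOpen k hU hyU]
  refine (norm_iteratedFDerivWithin_clm_apply hφ (hu₀.sub (hu j)) hU.uniqueDiffOn hyU
    (mod_cast le_top)).trans_lt ?_
  refine (Finset.sum_le_sum (g := fun i => (k.choose i : ℝ) * |C i| * (ε / (S + 1)))
    fun i hi => ?_).trans_lt ?_
  · rw [iteratedFDerivWithin_of_isOpen _ hU hyU, iteratedFDerivWithin_of_isOpen _ hU hyU]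
    have h1 : ‖iteratedFDeriv ℝ (k - i) (u₀ - u j) y‖ ≤ ε / (S + 1) := by
      rw [iteratedFDeriv_sub_apply ((hu₀.contDiffAt hyn).of_le (hle _))
        (((hu j).contDiffAt hyn).of_le (hle _)), ← dist_eq_norm]
      exact (hj i hi y hy).le
    gcongr
    · exact (hC i y hy).trans (le_abs_self _)
    · exact h1
  · rw [← Finset.sum_mul, ← hS, mul_div_assoc', div_lt_iff₀ (by positivity)]
    nlinarith

theorem tendstoUniformlyOn_of_forall_mem_nhds {ι α β : Type*} [TopologicalSpace α] [UniformSpace β]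
    {l : Filter ι} {f : ι → α → β} {g : α → β} {A : Set α} (hA : IsCompact A)
    (h : ∀ x ∈ A, ∃ B ∈ 𝓝 x, TendstoUniformlyOn f g l B) : TendstoUniformlyOn f g l A := by
  refine hA.induction_on (p := fun B => TendstoUniformlyOn f g l B) ?_ ?_ ?_ ?_
  · exact tendstoUniformlyOn_empty
  · exact fun s t hst ht => ht.mono hst
  · exact fun s t hs ht u hu => by
      filter_upwards [hs u hu, ht u hu] with j h₁ h₂ x hx using hx.elim (h₁ x) (h₂ x)
  · exact fun x hx => let ⟨B, hB, hf⟩ := h x hx; ⟨B, mem_nhdsWithin_of_mem_nhds hB, hf⟩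

end UniformConvergence

/-! ### The universal property of the inductive limit topology. -/

section LimitTopology

variable {E : Type*} [NormedAddCommGroup E] [NormedSpace ℝ E]
  {M : Type*} [TopologicalSpace M] [ChartedSpace E M]
  {F : Type*} [NormedAddCommGroup F] [NormedSpace ℝ F]
  {V : M → Type*} [TopologicalSpace (TotalSpace F V)] [∀ x, AddCommGroup (V x)]
  [∀ x, TopologicalSpace (V x)] [FiberBundle F V] [∀ x, Module ℝ (V x)] [VectorBundle ℝ F V]

theorem CompactSection.continuous_ofSupportedIn (A : TopologicalSpace.Compacts M) :
    @Continuous _ _ (TopologicalSpace.induced Subtype.val (smoothSectionTopology E F V)) _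
      (CompactSection.ofSupportedIn E F V A) := by
  rw [continuous_sInf_rng]
  exact fun t ht => ht.1 A

/-- The topology pulled back along `L` from `T` is locally convex and makes all the inclusions
continuous, so it is one of those over which the infimum is taken. -/
theorem CompactSection.continuous_of_forall_supportedIn {T : Type*} [AddCommGroup T] [Module ℝ T]
    [TopologicalSpace T] [IsTopologicalAddGroup T] [ContinuousSMul ℝ T] [LocallyConvexSpace ℝ T]
    (L : CompactSection E F V →ₗ[ℝ] T)
    (h : ∀ A : TopologicalSpace.Compacts M,
      @Continuous _ _ (TopologicalSpace.induced Subtype.val (smoothSectionTopology E F V)) _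
        fun s => L (CompactSection.ofSupportedIn E F V A s)) : Continuous L := by
  refine continuous_sInf_dom (t := TopologicalSpace.induced L inferInstance)
    ⟨fun A => continuous_induced_rng.2 (h A), topologicalAddGroup_induced L,
      continuousSMul_induced L, LocallyConvexSpace.induced L⟩ continuous_induced_dom

end LimitTopology

/-! ### Smooth bundle homomorphisms act continuously on sections. -/

section BundleHom

variable {E : Type*} [NormedAddCommGroup E] [NormedSpace ℝ E]
  {M : Type*} [TopologicalSpace M] [ChartedSpace E M]
  {F : Type*} [NormedAddCommGroup F] [NormedSpace ℝ F]
  {V : M → Type*} [TopologicalSpace (TotalSpace F V)] [∀ x, AddCommGroup (V x)]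
  [∀ x, TopologicalSpace (V x)] [FiberBundle F V] [∀ x, Module ℝ (V x)] [VectorBundle ℝ F V]
  {F' : Type*} [NormedAddCommGroup F'] [NormedSpace ℝ F']
  {W : M → Type*} [TopologicalSpace (TotalSpace F' W)] [∀ x, AddCommGroup (W x)]
  [∀ x, TopologicalSpace (W x)] [FiberBundle F' W] [∀ x, Module ℝ (W x)] [VectorBundle ℝ F' W]

variable (E F F') in
/-- A family of linear maps between the fibers of two vector bundles is smooth if it is given by
smooth maps with values in `F →L[ℝ] F'` in suitable local trivializations. -/
def IsSmoothBundleHom (Φ : ∀ x, V x →ₗ[ℝ] W x) : Prop :=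
  ∀ x₀ : M, ∃ (e : Trivialization F (Bundle.TotalSpace.proj : TotalSpace F V → M))
    (e' : Trivialization F' (Bundle.TotalSpace.proj : TotalSpace F' W → M))
    (_ : MemTrivializationAtlas e) (_ : MemTrivializationAtlas e') (U : Set M)
    (φ : M → F →L[ℝ] F'), IsOpen U ∧ x₀ ∈ U ∧ U ⊆ e.baseSet ∩ e'.baseSet ∧
      ContMDiffOn 𝓘(ℝ, E) 𝓘(ℝ, F →L[ℝ] F') ∞ φ U ∧
      ∀ y ∈ U, ∀ v : V y, (e' ⟨y, Φ y v⟩).2 = φ y (e ⟨y, v⟩).2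

namespace IsSmoothBundleHom

variable {Φ : ∀ x, V x →ₗ[ℝ] W x}

/-- A smooth bundle homomorphism is smooth in every trivialization of the target bundle. -/
theorem exists_rep [ContMDiffVectorBundle ∞ F' W 𝓘(ℝ, E)] (h : IsSmoothBundleHom E F F' Φ)
    (e' : Trivialization F' (Bundle.TotalSpace.proj : TotalSpace F' W → M))
    [MemTrivializationAtlas e'] {x₀ : M} (hx₀ : x₀ ∈ e'.baseSet) :
    ∃ (e : Trivialization F (Bundle.TotalSpace.proj : TotalSpace F V → M))
      (_ : MemTrivializationAtlas e) (U : Set M) (φ : M → F →L[ℝ] F'),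
      IsOpen U ∧ x₀ ∈ U ∧ U ⊆ e.baseSet ∩ e'.baseSet ∧
      ContMDiffOn 𝓘(ℝ, E) 𝓘(ℝ, F →L[ℝ] F') ∞ φ U ∧
      ∀ y ∈ U, ∀ v : V y, (e' ⟨y, Φ y v⟩).2 = φ y (e ⟨y, v⟩).2 := by
  obtain ⟨e, e₁, he, he₁, U, φ, hU, hxU, hsub, hφ, hrep⟩ := h x₀
  -- The given representative is corrected by the coordinate change from `e₁` to `e'`.
  refine ⟨e, he, U ∩ e'.baseSet,
    fun y => (e₁.coordChangeL ℝ e' y : F' →L[ℝ] F').comp (φ y), hU.inter e'.open_baseSet,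
    ⟨hxU, hx₀⟩, fun y hy => ⟨(hsub hy.1).1, hy.2⟩, ?_, ?_⟩
  · exact ((contMDiffOn_coordChangeL (n := ∞) (IB := 𝓘(ℝ, E)) e₁ e').mono
      fun y hy => ⟨(hsub hy.1).2, hy.2⟩).clm_comp (hφ.mono Set.inter_subset_left)
  · intro y hy v
    have h1 := (hsub hy.1).2
    simp only [ContinuousLinearMap.comp_apply, ContinuousLinearEquiv.coe_coe]
    rw [← hrep y hy.1, e₁.coordChangeL_apply e' ⟨h1, hy.2⟩, e₁.symm_proj_apply ⟨y, Φ y v⟩ h1]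

variable [ContMDiffVectorBundle ∞ F V 𝓘(ℝ, E)] [ContMDiffVectorBundle ∞ F' W 𝓘(ℝ, E)]

/-- The action of a smooth bundle homomorphism on smooth sections. -/
noncomputable def mapSection (h : IsSmoothBundleHom E F F' Φ) (s : Cₛ^∞⟮𝓘(ℝ, E); F, V⟯) :
    Cₛ^∞⟮𝓘(ℝ, E); F', W⟯ :=
  ⟨fun x => Φ x (s x), fun x₀ => by
    obtain ⟨e, e', he, he', U, φ, hU, hxU, hsub, hφ, hrep⟩ := h x₀
    refine (e'.contMDiffAt_section_iff (hsub hxU).2).2 ?_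
    have h1 := (e.contMDiffAt_section_iff (hsub hxU).1).1 (s.contMDiff x₀)
    refine ((hφ.contMDiffAt (hU.mem_nhds hxU)).clm_apply h1).congr_of_eventuallyEq ?_
    filter_upwards [hU.mem_nhds hxU] with y hy using hrep y hy _⟩

theorem sectionSupport_mapSection_subset (h : IsSmoothBundleHom E F F' Φ)
    (s : Cₛ^∞⟮𝓘(ℝ, E); F, V⟯) : sectionSupport (h.mapSection s) ⊆ sectionSupport s :=
  closure_mono fun x hx hs => hx (by
    have hs' : s x = 0 := hs
    change Φ x (s x) = 0
    rw [hs', map_zero])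

/-- The action of a smooth bundle homomorphism on compactly supported smooth sections. -/
noncomputable def mapCompactSection (h : IsSmoothBundleHom E F F' Φ) :
    CompactSection E F V →ₗ[ℝ] CompactSection E F' W where
  toFun s := ⟨h.mapSection s.1,
    s.2.of_isClosed_subset isClosed_closure (h.sectionSupport_mapSection_subset s.1)⟩
  map_add' s t := CompactSection.ext fun x => map_add (Φ x) (s x) (t x)
  map_smul' a s := CompactSection.ext fun x => map_smul (Φ x) a (s x)

end IsSmoothBundleHom

variable [IsManifold 𝓘(ℝ, E) ∞ M] [ContMDiffVectorBundle ∞ F V 𝓘(ℝ, E)]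

theorem contDiffOn_localRepresentative
    (e : Trivialization F (Bundle.TotalSpace.proj : TotalSpace F V → M)) [MemTrivializationAtlas e]
    {c : OpenPartialHomeomorph M E} (hc : c ∈ atlas E M) (s : Cₛ^∞⟮𝓘(ℝ, E); F, V⟯) :
    ContDiffOn ℝ ∞ (fun y : E => (e ⟨c.symm y, s (c.symm y)⟩).2)
      (c.target ∩ c.symm ⁻¹' e.baseSet) := by
  have h1 := (e.contMDiffOn_section_baseSet_iff (n := ∞) (IB := 𝓘(ℝ, E)) (s := s)).1
    s.contMDiff.contMDiffOn
  have h2 := contMDiffOn_symm_of_mem_maximalAtlas (I := 𝓘(ℝ, E)) (n := ∞)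
    (IsManifold.subset_maximalAtlas hc)
  exact (h1.comp (h2.mono Set.inter_subset_left) fun y hy => hy.2).contDiffOn

variable [FiniteDimensional ℝ E] [ContMDiffVectorBundle ∞ F' W 𝓘(ℝ, E)]
  {Φ : ∀ x, V x →ₗ[ℝ] W x}

/-- In charts the image section is the given one multiplied by a smooth operator-valued function, so
each derivative converges uniformly on compact sets once all derivatives of the given section do. -/
theorem IsSmoothBundleHom.continuous_mapSection (h : IsSmoothBundleHom E F F' Φ) :
    @Continuous _ _ (smoothSectionTopology E F V) (smoothSectionTopology E F' W)
      h.mapSection := by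
  let _ : TopologicalSpace Cₛ^∞⟮𝓘(ℝ, E); F, V⟯ := smoothSectionTopology E F V
  simp only [continuous_iInf_rng]
  intro e' he' c hc k
  rw [continuous_induced_rng, continuous_iff_continuousAt]
  intro s₀
  rw [ContinuousAt, UniformOnFun.tendsto_iff_tendstoUniformlyOn]
  rintro A ⟨hA, hAsub⟩
  -- `A` need not lie in the domain of a single trivialization of `V`, so it is covered by compact
  -- pieces `B` that do.
  refine tendstoUniformlyOn_of_forall_mem_nhds hA fun y₀ hy₀ => ?_
  obtain ⟨e, he, U, φ, hU, hxU, hsub, hφ, hrep⟩ := h.exists_rep e' (hAsub hy₀).2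
  have hO : IsOpen (c.target ∩ c.symm ⁻¹' U) := c.symm.isOpen_inter_preimage hU
  obtain ⟨B, hB, hBsub, hBc⟩ := local_compact_nhds (hO.mem_nhds ⟨(hAsub hy₀).1, hxU⟩)
  refine ⟨B, hB, ?_⟩
  have hOe : c.target ∩ c.symm ⁻¹' U ⊆ c.target ∩ c.symm ⁻¹' e.baseSet :=
    fun y hy => ⟨hy.1, (hsub hy.2).1⟩
  have hs : ∀ s : Cₛ^∞⟮𝓘(ℝ, E); F, V⟯,
      ContDiffOn ℝ ∞ (fun y : E => (e ⟨c.symm y, s (c.symm y)⟩).2) (c.target ∩ c.symm ⁻¹' U) :=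
    fun s => (contDiffOn_localRepresentative e hc s).mono hOe
  have h2 := contMDiffOn_symm_of_mem_maximalAtlas (I := 𝓘(ℝ, E)) (n := ∞)
    (IsManifold.subset_maximalAtlas hc)
  have hφ' : ContDiffOn ℝ ∞ (φ ∘ c.symm) (c.target ∩ c.symm ⁻¹' U) :=
    (hφ.comp (h2.mono Set.inter_subset_left) fun y hy => hy.2).contDiffOn
  have key := tendstoUniformlyOn_iteratedFDeriv_clm_apply hO hBc hBsub hφ'
    (l := 𝓝 s₀) (u := fun (s : Cₛ^∞⟮𝓘(ℝ, E); F, V⟯) y => (e ⟨c.symm y, s (c.symm y)⟩).2)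
    (u₀ := fun y => (e ⟨c.symm y, s₀ (c.symm y)⟩).2) (fun s => hs s) (hs s₀) k (fun i => by
      have hcont : Continuous fun s : Cₛ^∞⟮𝓘(ℝ, E); F, V⟯ =>
          UniformOnFun.ofFun {A : Set E | IsCompact A ∧ A ⊆ c.target ∩ c.symm ⁻¹' e.baseSet}
            (iteratedFDeriv ℝ i fun y : E => (e ⟨c.symm y, s (c.symm y)⟩).2) := by
        rw [continuous_iff_le_induced]
        exact iInf_le_of_le e <| iInf_le_of_le he <| iInf_le_of_le c <| iInf_le_of_le hc <|
          iInf_le_of_le i le_rfl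
      exact UniformOnFun.tendsto_iff_tendstoUniformlyOn.1 (hcont.tendsto s₀) B
        ⟨hBc, hBsub.trans hOe⟩)
  have heq : ∀ s : Cₛ^∞⟮𝓘(ℝ, E); F, V⟯, ∀ y ∈ B,
      iteratedFDeriv ℝ k (fun y => (φ ∘ c.symm) y (e ⟨c.symm y, s (c.symm y)⟩).2) y =
        iteratedFDeriv ℝ k (fun y => (e' ⟨c.symm y, h.mapSection s (c.symm y)⟩).2) y := by
    intro s y hy
    refine Filter.EventuallyEq.eq_of_nhds (Filter.EventuallyEq.iteratedFDeriv ℝ ?_ k)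
    filter_upwards [hO.mem_nhds (hBsub hy)] with z hz
    exact (hrep _ hz.2 _).symm
  exact (key.congr (.of_forall fun s y hy => heq s y hy)).congr_right fun y hy => heq s₀ y hy

/-- Supports do not grow, so `C_A^∞(M, V)` is mapped into `C_A^∞(M, W)` for the same `A`, and the
universal property applies. -/
theorem IsSmoothBundleHom.continuous_mapCompactSection (h : IsSmoothBundleHom E F F' Φ) :
    Continuous h.mapCompactSection := by
  refine CompactSection.continuous_of_forall_supportedIn _ fun A => ?_
  let _ : TopologicalSpace (sectionsSupportedIn E F V A) :=
    TopologicalSpace.induced Subtype.val (smoothSectionTopology E F V)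
  let _ : TopologicalSpace (sectionsSupportedIn E F' W A) :=
    TopologicalSpace.induced Subtype.val (smoothSectionTopology E F' W)
  let S : sectionsSupportedIn E F V A → sectionsSupportedIn E F' W A := fun s =>
    ⟨h.mapSection s.1, (h.sectionSupport_mapSection_subset s.1).trans s.2⟩
  have hS : Continuous S := by
    refine continuous_induced_rng.2 ?_
    exact @Continuous.comp _ _ _ _ (smoothSectionTopology E F V) (smoothSectionTopology E F' W)
      _ _ h.continuous_mapSection continuous_induced_dom
  exact (CompactSection.continuous_ofSupportedIn A).comp hS

end BundleHom

/-! ### Cut-off bundle homomorphisms and sections. -/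

section LocalConstructions

variable {E : Type*} [NormedAddCommGroup E] [NormedSpace ℝ E]
  {M : Type*} [TopologicalSpace M] [ChartedSpace E M]
  {F : Type*} [NormedAddCommGroup F] [NormedSpace ℝ F]
  {V : M → Type*} [TopologicalSpace (TotalSpace F V)] [∀ x, AddCommGroup (V x)]
  [∀ x, TopologicalSpace (V x)] [FiberBundle F V] [∀ x, Module ℝ (V x)] [VectorBundle ℝ F V]
  {F' : Type*} [NormedAddCommGroup F'] [NormedSpace ℝ F']
  {W : M → Type*} [TopologicalSpace (TotalSpace F' W)] [∀ x, AddCommGroup (W x)]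
  [∀ x, TopologicalSpace (W x)] [FiberBundle F' W] [∀ x, Module ℝ (W x)] [VectorBundle ℝ F' W]

theorem CompactSection.sum_apply {ι : Type*} (t : Finset ι) (s : ι → CompactSection E F V) (x : M) :
    (∑ i ∈ t, s i) x = ∑ i ∈ t, s i x :=
  map_sum ({ toFun := fun s : CompactSection E F V => s x, map_zero' := rfl,
             map_add' := fun _ _ => rfl } : CompactSection E F V →+ V x) s t

theorem Bundle.Trivialization.apply_symmₗ_snd
    (e : Trivialization F (Bundle.TotalSpace.proj : TotalSpace F V → M)) [MemTrivializationAtlas e]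
    {x : M} (hx : x ∈ e.baseSet) (u : F) : (e ⟨x, e.symmₗ ℝ x u⟩).2 = u := by
  have h := e.linearMapAt_symmₗ (R := ℝ) hx u
  rwa [e.linearMapAt_apply, if_pos hx] at h

theorem Bundle.Trivialization.symmₗ_apply_snd
    (e : Trivialization F (Bundle.TotalSpace.proj : TotalSpace F V → M)) [MemTrivializationAtlas e]
    {x : M} (hx : x ∈ e.baseSet) (w : V x) : e.symmₗ ℝ x (e ⟨x, w⟩).2 = w := by
  have h := e.symmₗ_linearMapAt (R := ℝ) hx w
  rwa [e.linearMapAt_apply, if_pos hx] at h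

theorem Bundle.Trivialization.snd_smul
    (e : Trivialization F (Bundle.TotalSpace.proj : TotalSpace F V → M)) [MemTrivializationAtlas e]
    {x : M} (hx : x ∈ e.baseSet) (a : ℝ) (w : V x) : (e ⟨x, a • w⟩).2 = a • (e ⟨x, w⟩).2 :=
  (e.linear ℝ hx).map_smul a w

theorem Bundle.Trivialization.snd_add
    (e : Trivialization F (Bundle.TotalSpace.proj : TotalSpace F V → M)) [MemTrivializationAtlas e]
    {x : M} (hx : x ∈ e.baseSet) (v w : V x) :
    (e ⟨x, v + w⟩).2 = (e ⟨x, v⟩).2 + (e ⟨x, w⟩).2 :=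
  (e.linear ℝ hx).map_add v w

/-- A linear map between typical fibers, cut off by a smooth function `ρ` and transported to the
fibers by two trivializations, is a smooth bundle homomorphism. -/
theorem isSmoothBundleHom_cutoff
    (e : Trivialization F (Bundle.TotalSpace.proj : TotalSpace F V → M))
    (e' : Trivialization F' (Bundle.TotalSpace.proj : TotalSpace F' W → M))
    [MemTrivializationAtlas e] [MemTrivializationAtlas e'] (ρ : C^∞⟮𝓘(ℝ, E), M; ℝ⟯)
    (hρ : tsupport ρ ⊆ e.baseSet ∩ e'.baseSet) (L : F →L[ℝ] F') :
    IsSmoothBundleHom E F F' fun x =>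
      ρ x • (e'.symmₗ ℝ x ∘ₗ (L : F →ₗ[ℝ] F') ∘ₗ e.linearMapAt ℝ x) := by
  intro x₀
  by_cases hx : x₀ ∈ e.baseSet ∩ e'.baseSet
  · refine ⟨e, e', ‹_›, ‹_›, e.baseSet ∩ e'.baseSet, fun y => ρ y • L,
      e.open_baseSet.inter e'.open_baseSet, hx, subset_rfl, ?_, fun y hy v => ?_⟩
    · exact (ρ.contMDiff.smul contMDiff_const).contMDiffOn
    · simp only [LinearMap.smul_apply, LinearMap.comp_apply, _root_.smul_apply]
      rw [e'.snd_smul hy.2, e'.apply_symmₗ_snd hy.2, e.linearMapAt_apply, if_pos hy.1]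
      rfl
  -- Here `x₀` lies outside the support of `ρ`, so the homomorphism vanishes near `x₀` and is
  -- represented by zero in any trivializations.
  · refine ⟨trivializationAt F V x₀, trivializationAt F' W x₀, inferInstance, inferInstance,
      (trivializationAt F V x₀).baseSet ∩ (trivializationAt F' W x₀).baseSet ∩ (tsupport ρ)ᶜ,
      fun _ => 0, ?_, ⟨⟨FiberBundle.mem_baseSet_trivializationAt' x₀,
        FiberBundle.mem_baseSet_trivializationAt' x₀⟩, fun h => hx (hρ h)⟩,
      Set.inter_subset_left, contMDiffOn_const, fun y hy v => ?_⟩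
    · exact (((trivializationAt F V x₀).open_baseSet.inter
        (trivializationAt F' W x₀).open_baseSet).inter (isClosed_tsupport _).isOpen_compl)
    · have h0 : ρ y = 0 := image_eq_zero_of_notMem_tsupport hy.2
      have h1 := (trivializationAt F' W x₀).snd_smul hy.1.2 0 (0 : W y)
      simpa [h0] using h1

section
variable [ContMDiffVectorBundle ∞ F V 𝓘(ℝ, E)]

/-- The section which is constant equal to `u` in a trivialization, cut off by a smooth function. -/
noncomputable def cutoffSection
    (e : Trivialization F (Bundle.TotalSpace.proj : TotalSpace F V → M)) [MemTrivializationAtlas e]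
    (f : C^∞⟮𝓘(ℝ, E), M; ℝ⟯) (hf : HasCompactSupport f) (hfe : tsupport f ⊆ e.baseSet) :
    F →ₗ[ℝ] CompactSection E F V where
  toFun u := ⟨⟨fun x => f x • e.symmₗ ℝ x u, fun x₀ => by
      by_cases hx : x₀ ∈ e.baseSet
      · refine (e.contMDiffAt_section_iff hx).2 ?_
        refine (f.contMDiff.contMDiffAt.smul contMDiffAt_const).congr_of_eventuallyEq
          (f := fun x => f x • u) ?_
        filter_upwards [e.open_baseSet.mem_nhds hx] with y hy
        rw [e.snd_smul hy, e.apply_symmₗ_snd hy]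
      · refine (contMDiffAt_zeroSection ℝ V).congr_of_eventuallyEq ?_
        filter_upwards [(isClosed_tsupport f).isOpen_compl.mem_nhds fun h => hx (hfe h)] with y hy
        simp [image_eq_zero_of_notMem_tsupport hy, zeroSection]⟩,
    hf.of_isClosed_subset isClosed_closure <| closure_mono fun x hx h => hx (by
      change f x • e.symmₗ ℝ x u = 0
      rw [h, zero_smul])⟩
  map_add' u v := CompactSection.ext fun x => by
    change f x • e.symmₗ ℝ x (u + v) = f x • e.symmₗ ℝ x u + f x • e.symmₗ ℝ x v
    rw [map_add, smul_add]
  map_smul' a u := CompactSection.ext fun x => by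
    change f x • e.symmₗ ℝ x (a • u) = a • f x • e.symmₗ ℝ x u
    rw [map_smul, smul_comm]

theorem cutoffSection_apply
    (e : Trivialization F (Bundle.TotalSpace.proj : TotalSpace F V → M)) [MemTrivializationAtlas e]
    (f : C^∞⟮𝓘(ℝ, E), M; ℝ⟯) (hf : HasCompactSupport f) (hfe : tsupport f ⊆ e.baseSet) (u : F)
    (x : M) : cutoffSection e f hf hfe u x = f x • e.symmₗ ℝ x u := rfl
end

set_option synthInstance.maxHeartbeats 400000 in
set_option maxHeartbeats 1000000 in
theorem ContMDiffOn.compL_clm {G : Type*} [NormedAddCommGroup G] [NormedSpace ℝ G] {g : M → G}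
    {s : Set M} (hg : ContMDiffOn 𝓘(ℝ, E) 𝓘(ℝ, G) ∞ g s) (B : G →L[ℝ] F →L[ℝ] F') :
    ContMDiffOn 𝓘(ℝ, E) 𝓘(ℝ, (E →L[ℝ] F) →L[ℝ] (E →L[ℝ] F')) ∞
      (fun y => ContinuousLinearMap.compL ℝ E F F' (B (g y))) s := by
  have h₁ : ContMDiff 𝓘(ℝ, G) 𝓘(ℝ, (E →L[ℝ] F) →L[ℝ] (E →L[ℝ] F')) ∞
      ((ContinuousLinearMap.compL ℝ E F F').comp B) := ContinuousLinearMap.contMDiff _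
  exact h₁.comp_contMDiffOn hg

set_option synthInstance.maxHeartbeats 400000 in
set_option maxHeartbeats 1000000 in
theorem ContMDiffOn.flip_compL_comp {G : Type*} [NormedAddCommGroup G] [NormedSpace ℝ G]
    {g : M → E →L[ℝ] F} {s : Set M} (hg : ContMDiffOn 𝓘(ℝ, E) 𝓘(ℝ, E →L[ℝ] F) ∞ g s)
    (B : G →L[ℝ] F →L[ℝ] F') :
    ContMDiffOn 𝓘(ℝ, E) 𝓘(ℝ, G →L[ℝ] (E →L[ℝ] F')) ∞
      (fun y => ((ContinuousLinearMap.compL ℝ E F F').flip (g y)).comp B) s :=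
  ((ContinuousLinearMap.compL ℝ E F F').flip.contMDiff.comp_contMDiffOn hg).clm_comp
    contMDiffOn_const

theorem exists_contMDiffMap_eventuallyEq_one [T2Space M] [IsManifold 𝓘(ℝ, E) ∞ M]
    [FiniteDimensional ℝ E] {x : M} {U : Set M} (hU : U ∈ 𝓝 x) :
    ∃ f : C^∞⟮𝓘(ℝ, E), M; ℝ⟯, HasCompactSupport f ∧ tsupport f ⊆ U ∧ f =ᶠ[𝓝 x] 1 := by
  obtain ⟨f, -, hf⟩ := (SmoothBumpFunction.nhds_basis_tsupport (I := 𝓘(ℝ, E)) x).mem_iff.1 hU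
  exact ⟨⟨f, f.contMDiff⟩, f.hasCompactSupport, hf, f.eventuallyEq_one⟩

end LocalConstructions

/-- Lift `w` by a linear section of `L ⊗ L → V_L` and expand the second tensor factor in a basis.
The `b i` do not depend on `w` and the `l i` are linear, which is what later makes the decomposition
of sections continuous. -/
theorem InvForm.exists_sum_kappa (L : Type*) [LieRing L] [LieAlgebra ℝ L] [FiniteDimensional ℝ L] :
    ∃ (n : ℕ) (l : Fin n → InvForm L →ₗ[ℝ] L) (b : Fin n → L),
      ∀ w, ∑ i, InvForm.kappa L (l i w) (b i) = w := by
  obtain ⟨s, hs⟩ := LinearMap.exists_rightInverse_of_surjective (InvForm.proj L)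
    (LinearMap.range_eq_top.2 InvForm.proj_surjective)
  let b := Module.finBasis ℝ L
  refine ⟨_, fun i => Finsupp.lapply i ∘ₗ
    (TensorProduct.equivFinsuppOfBasisRight (M := L) b).toLinearMap ∘ₗ s, b, fun w => ?_⟩
  have h := (TensorProduct.equivFinsuppOfBasisRight (M := L) b).symm_apply_apply (s w)
  rw [TensorProduct.equivFinsuppOfBasisRight_symm_apply, Finsupp.sum_fintype _ _ (by simp)] at h
  have h' := congrArg (InvForm.proj L) h
  rw [map_sum] at h'
  exact h'.trans (LinearMap.congr_fun hs w)

theorem linearMapAt_trivializationAt_invFormBundle {M : Type*} [TopologicalSpace M]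
    {𝔤 : Type*} [NormedLieRing 𝔤] [NormedLieAlgebra 𝔤] [FiniteDimensional ℝ 𝔤]
    {K : M → Type*} [∀ x, LieRing (K x)] [∀ x, LieAlgebra ℝ (K x)] [∀ x, TopologicalSpace (K x)]
    [TopologicalSpace (TotalSpace 𝔤 K)] [FiberBundle 𝔤 K] [VectorBundle ℝ 𝔤 K]
    [LieAlgebraBundle 𝔤 K] (p : M) {x : M}
    (hx : x ∈ (trivializationAt 𝔤 K p).baseSet) :
    (trivializationAt (InvForm 𝔤) (InvFormBundle K) p).linearMapAt ℝ x =
      invFormTriv (trivializationAt 𝔤 K p) x := by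
  ext w
  exact congrFun ((trivializationAt (InvForm 𝔤) (InvFormBundle K) p).coe_linearMapAt_of_mem
    (R := ℝ) hx) w

/-! ### Separate continuity of `κ̃` and continuity of `β` in its first argument. -/

section KappaContinuity

variable {E : Type*} [NormedAddCommGroup E] [NormedSpace ℝ E] [FiniteDimensional ℝ E]
  {M : Type*} [TopologicalSpace M] [ChartedSpace E M] [IsManifold 𝓘(ℝ, E) ∞ M]
  {𝔤 : Type*} [NormedLieRing 𝔤] [NormedLieAlgebra 𝔤] [FiniteDimensional ℝ 𝔤]
  {K : M → Type*} [∀ x, LieRing (K x)] [∀ x, LieAlgebra ℝ (K x)] [∀ x, TopologicalSpace (K x)]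
  [∀ x, IsTopologicalAddGroup (K x)] [∀ x, ContinuousSMul ℝ (K x)]
  [TopologicalSpace (TotalSpace 𝔤 K)] [FiberBundle 𝔤 K] [VectorBundle ℝ 𝔤 K]
  [LieAlgebraBundle 𝔤 K]

-- In coordinates the pairing is the fixed bilinear map built from `κ_𝔤` and composition. Fixing a
-- smooth section in one slot therefore gives smooth coefficients for the bundle homomorphism in the
-- other slot.
variable (E 𝔤 K) in
theorem trivializationAt_kappaTangent (x₀ : M) {x : M}
    (hx : x ∈ (trivializationAt 𝔤 K x₀).baseSet) (α : TangentSpace 𝓘(ℝ, E) x →L[ℝ] K x) (u : K x) :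
    (trivializationAt (E →L[ℝ] InvForm 𝔤)
        (fun x : M => TangentSpace 𝓘(ℝ, E) x →L[ℝ] InvFormBundle K x) x₀
        ⟨x, kappaTangent x α u⟩).2 =
      ((kappaCLM 𝔤).flip (trivializationAt 𝔤 K x₀ ⟨x, u⟩).2).comp
        (trivializationAt (E →L[ℝ] 𝔤) (fun x : M => TangentSpace 𝓘(ℝ, E) x →L[ℝ] K x) x₀
          ⟨x, α⟩).2 := by
  ext v
  have hV : ∀ w : InvFormBundle K x,
      (trivializationAt (InvForm 𝔤) (InvFormBundle K) x₀).continuousLinearMapAt ℝ x w =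
        (trivializationAt (InvForm 𝔤) (InvFormBundle K) x₀ ⟨x, w⟩).2 := fun w =>
    congrFun ((trivializationAt (InvForm 𝔤) (InvFormBundle K) x₀).coe_linearMapAt_of_mem
      (R := ℝ) hx) w
  have hK : ∀ w : K x, (trivializationAt 𝔤 K x₀).continuousLinearMapAt ℝ x w =
        (trivializationAt 𝔤 K x₀ ⟨x, w⟩).2 := fun w =>
    congrFun ((trivializationAt 𝔤 K x₀).coe_linearMapAt_of_mem (R := ℝ) hx) w
  refine (hV _).trans ((trivializationAt_kappaFiber x₀ hx _ _).trans ?_)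
  rw [← hK]
  rfl

variable [ContMDiffVectorBundle ∞ 𝔤 K 𝓘(ℝ, E)]

theorem isSmoothBundleHom_kappaTangent_left (η : CompactSection E 𝔤 K) :
    IsSmoothBundleHom E (E →L[ℝ] 𝔤) (E →L[ℝ] InvForm 𝔤)
      (V := fun x : M => TangentSpace 𝓘(ℝ, E) x →L[ℝ] K x)
      (W := fun x : M => TangentSpace 𝓘(ℝ, E) x →L[ℝ] InvFormBundle K x)
      fun x =>
        { toFun := fun α => kappaTangent x α (η x)
          map_add' := fun α β => by ext v; simp [kappaTangent]
          map_smul' := fun a α => by ext v; simp [kappaTangent] } := by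
  intro x₀
  have h := (trivializationAt 𝔤 K x₀).contMDiffOn_section_baseSet_iff (n := ∞) (IB := 𝓘(ℝ, E))
    |>.1 η.1.contMDiff.contMDiffOn
  refine ⟨trivializationAt _ _ x₀, trivializationAt _ _ x₀, inferInstance, inferInstance,
    (trivializationAt 𝔤 K x₀).baseSet ∩ ((trivializationAt (E →L[ℝ] 𝔤)
      (fun x : M => TangentSpace 𝓘(ℝ, E) x →L[ℝ] K x) x₀).baseSet ∩
      (trivializationAt (E →L[ℝ] InvForm 𝔤)
        (fun x : M => TangentSpace 𝓘(ℝ, E) x →L[ℝ] InvFormBundle K x) x₀).baseSet),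
    fun y => ContinuousLinearMap.compL ℝ E 𝔤 (InvForm 𝔤)
      ((kappaCLM 𝔤).flip (trivializationAt 𝔤 K x₀ ⟨y, η y⟩).2), ?_, ?_,
    Set.inter_subset_right, ?_, ?_⟩
  · exact (Trivialization.open_baseSet _).inter
      ((Trivialization.open_baseSet _).inter (Trivialization.open_baseSet _))
  · exact ⟨FiberBundle.mem_baseSet_trivializationAt' x₀,
      FiberBundle.mem_baseSet_trivializationAt' x₀, FiberBundle.mem_baseSet_trivializationAt' x₀⟩
  · exact (h.compL_clm (kappaCLM 𝔤).flip).mono Set.inter_subset_left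
  · exact fun y hy α => trivializationAt_kappaTangent E 𝔤 K x₀ hy.1 α (η y)

theorem isSmoothBundleHom_kappaTangent_right (α : CompactOneForm E 𝔤 K) :
    IsSmoothBundleHom E 𝔤 (E →L[ℝ] InvForm 𝔤) (V := K)
      (W := fun x : M => TangentSpace 𝓘(ℝ, E) x →L[ℝ] InvFormBundle K x)
      fun x =>
        { toFun := fun u => kappaTangent x (α x) u
          map_add' := fun u v => by ext w; simp [kappaTangent]
          map_smul' := fun a u => by ext w; simp [kappaTangent] } := by
  intro x₀
  have h := (trivializationAt (E →L[ℝ] 𝔤) (fun x : M => TangentSpace 𝓘(ℝ, E) x →L[ℝ] K x)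
    x₀).contMDiffOn_section_baseSet_iff (n := ∞) (IB := 𝓘(ℝ, E)) |>.1 α.1.contMDiff.contMDiffOn
  refine ⟨trivializationAt _ _ x₀, trivializationAt _ _ x₀, inferInstance, inferInstance,
    (trivializationAt (E →L[ℝ] 𝔤) (fun x : M => TangentSpace 𝓘(ℝ, E) x →L[ℝ] K x) x₀).baseSet ∩
      ((trivializationAt 𝔤 K x₀).baseSet ∩ (trivializationAt (E →L[ℝ] InvForm 𝔤)
        (fun x : M => TangentSpace 𝓘(ℝ, E) x →L[ℝ] InvFormBundle K x) x₀).baseSet),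
    fun y => ((ContinuousLinearMap.compL ℝ E 𝔤 (InvForm 𝔤)).flip
      (trivializationAt (E →L[ℝ] 𝔤) (fun x : M => TangentSpace 𝓘(ℝ, E) x →L[ℝ] K x) x₀
        ⟨y, α y⟩).2).comp (kappaCLM 𝔤).flip, ?_, ?_, Set.inter_subset_right, ?_, ?_⟩
  · exact (Trivialization.open_baseSet _).inter
      ((Trivialization.open_baseSet _).inter (Trivialization.open_baseSet _))
  · exact ⟨FiberBundle.mem_baseSet_trivializationAt' x₀,
      FiberBundle.mem_baseSet_trivializationAt' x₀, FiberBundle.mem_baseSet_trivializationAt' x₀⟩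
  · exact (h.flip_compL_comp (kappaCLM 𝔤).flip).mono Set.inter_subset_left
  · exact fun y hy u => trivializationAt_kappaTangent E 𝔤 K x₀ hy.2.1 (α y) u

theorem continuous_kappaOneForm_left (η : CompactSection E 𝔤 K) :
    Continuous fun α : CompactOneForm E 𝔤 K => kappaOneForm α η :=
  (isSmoothBundleHom_kappaTangent_left η).continuous_mapCompactSection

theorem continuous_kappaOneForm_right (α : CompactOneForm E 𝔤 K) :
    Continuous fun η : CompactSection E 𝔤 K => kappaOneForm α η :=
  (isSmoothBundleHom_kappaTangent_right α).continuous_mapCompactSection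

/-- For fixed `η` the first summand is `D` followed by pairing with `η`, the second is pairing with
the fixed form `D η`; separate continuity of the pairing suffices. -/
theorem continuous_betaForm_left {D : CompactSection E 𝔤 K →ₗ[ℝ] CompactOneForm E 𝔤 K}
    (hD : Continuous D) (η : CompactSection E 𝔤 K) : Continuous fun ζ => betaForm D ζ η :=
  ((continuous_kappaOneForm_left η).comp hD).add (continuous_kappaOneForm_right (D η))

end KappaContinuity

/-! ### Writing sections of `V(K)` as finite sums of values of `κ`. -/

section Decomposition

universe u

variable {E : Type*} [NormedAddCommGroup E] [NormedSpace ℝ E] [FiniteDimensional ℝ E]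
  {M : Type u} [TopologicalSpace M] [T2Space M] [SigmaCompactSpace M]
  [ChartedSpace E M] [IsManifold 𝓘(ℝ, E) ∞ M]
  {𝔤 : Type*} [NormedLieRing 𝔤] [NormedLieAlgebra 𝔤] [FiniteDimensional ℝ 𝔤]
  {K : M → Type*} [∀ x, LieRing (K x)] [∀ x, LieAlgebra ℝ (K x)] [∀ x, TopologicalSpace (K x)]
  [TopologicalSpace (TotalSpace 𝔤 K)] [FiberBundle 𝔤 K] [VectorBundle ℝ 𝔤 K]
  [ContMDiffVectorBundle ∞ 𝔤 K 𝓘(ℝ, E)] [LieAlgebraBundle 𝔤 K]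

/-- Two families are needed because both arguments of `κ` have to be cut off: `ρ i` for the bundle
homomorphism, `f i` for the constant section. Bump functions `f i` are chosen first, and the
partition of unity is subordinate to the interiors of the sets where `f i = 1`, so that `ρ i * f i =
ρ i`. -/
theorem exists_contMDiffMap_sum_mul_eq_one {A : Set M} (hA : IsCompact A) {U : M → Set M}
    (hU : ∀ x, U x ∈ 𝓝 x) :
    ∃ (t : Finset M) (ρ f : t → C^∞⟮𝓘(ℝ, E), M; ℝ⟯), (∀ i, tsupport (ρ i) ⊆ U i) ∧
      (∀ i, HasCompactSupport (f i)) ∧ (∀ i, tsupport (f i) ⊆ U i) ∧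
      ∀ x ∈ A, ∑ i, ρ i x * f i x = 1 := by
  choose f hfc hfU hf1 using fun x => exists_contMDiffMap_eventuallyEq_one (E := E) (hU x)
  obtain ⟨t, -, ht⟩ := hA.elim_nhds_subcover (fun x => interior {y | f x y = 1})
    fun x _ => interior_mem_nhds.2 (hf1 x)
  obtain ⟨ρ, hρ⟩ := SmoothPartitionOfUnity.exists_isSubordinate 𝓘(ℝ, E) hA.isClosed
    (fun i : t => interior {y | f i y = 1}) (fun _ => isOpen_interior) fun x hx => by
      obtain ⟨i, hi, hxi⟩ := Set.mem_iUnion₂.1 (ht hx)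
      exact Set.mem_iUnion.2 ⟨⟨i, hi⟩, hxi⟩
  have hρ1 : ∀ i : t, ∀ x ∈ tsupport (ρ i), f i x = 1 := fun i x hx => by
    have h : x ∈ {y | f i y = 1} := interior_subset (hρ i hx)
    exact h
  refine ⟨t, ρ, fun i => f i, fun i x hx => hfU i (subset_tsupport _ ?_), fun i => hfc i,
    fun i => hfU i, fun x hx => ?_⟩
  · rw [Function.mem_support, hρ1 i x hx]
    exact one_ne_zero
  · rw [← ρ.sum_eq_one hx, finsum_eq_sum_of_fintype]
    refine Finset.sum_congr rfl fun i _ => ?_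
    by_cases h : x ∈ tsupport (ρ i)
    · rw [hρ1 i x h, mul_one]
    · rw [image_eq_zero_of_notMem_tsupport h, zero_mul]

variable (𝔤 K) in
/-- Sections of `V(K)` supported in a compact set are sums of sections `κ(λ i σ, ε i)`, where the
`λ i` are given by smooth bundle homomorphisms. -/
theorem exists_sum_kappaSection (A : TopologicalSpace.Compacts M) :
    ∃ (ι : Type u) (_ : Fintype ι) (Φ : ι → ∀ x, InvFormBundle K x →ₗ[ℝ] K x)
      (hΦ : ∀ i, IsSmoothBundleHom E (InvForm 𝔤) 𝔤 (Φ i)) (ε : ι → CompactSection E 𝔤 K),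
      ∀ σ : CompactSection E (InvForm 𝔤) (InvFormBundle K), sectionSupport σ.1 ⊆ A →
        ∑ i, kappaSection ((hΦ i).mapCompactSection σ) (ε i) = σ := by
  obtain ⟨n, l, b, hlb⟩ := InvForm.exists_sum_kappa 𝔤
  obtain ⟨t, ρ, f, hρ, hfc, hf, hsum⟩ := exists_contMDiffMap_sum_mul_eq_one (E := E) A.isCompact
    fun x => (trivializationAt 𝔤 K x).open_baseSet.mem_nhds
      (FiberBundle.mem_baseSet_trivializationAt' x)
  -- In the trivialization at `p`, `Φ (p, i)` is `ρ p` times `l i`, and `ε (p, i)` is `f p` times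
  -- the constant section `b i`.
  refine ⟨t × Fin n, inferInstance, fun i x => ρ i.1 x • ((trivializationAt 𝔤 K i.1.1).symmₗ ℝ x ∘ₗ
      (LinearMap.toContinuousLinearMap (l i.2) : InvForm 𝔤 →ₗ[ℝ] 𝔤) ∘ₗ
      (trivializationAt (InvForm 𝔤) (InvFormBundle K) i.1.1).linearMapAt ℝ x),
    fun i => isSmoothBundleHom_cutoff (trivializationAt (InvForm 𝔤) (InvFormBundle K) i.1.1)
      (trivializationAt 𝔤 K i.1.1) (ρ i.1) (fun x hx => ⟨hρ i.1 hx, hρ i.1 hx⟩) _,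
    fun i => cutoffSection (trivializationAt 𝔤 K i.1.1) (f i.1) (hfc i.1) (hf i.1) (b i.2),
    fun σ hσ => CompactSection.ext fun x => ?_⟩
  rw [CompactSection.sum_apply]
  by_cases hx : x ∈ A
  · rw [Fintype.sum_prod_type]
    -- Over the base set this is the identity `∑ κ(l i w, b i) = w` carried to the fiber by the
    -- inverse trivialization; elsewhere `ρ p x = 0`.
    have key : ∀ p : t, ∀ w : InvFormBundle K x, ∑ i,
        kappaFiber K x (ρ p x • (trivializationAt 𝔤 K p.1).symmₗ ℝ x
          (l i ((trivializationAt (InvForm 𝔤) (InvFormBundle K) p.1).linearMapAt ℝ x w)))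
          (f p x • (trivializationAt 𝔤 K p.1).symmₗ ℝ x (b i)) = (ρ p x * f p x) • w := by
      intro p w
      simp only [map_smul, LinearMap.smul_apply, smul_smul]
      rw [← Finset.smul_sum, mul_comm (f p x)]
      by_cases hp : x ∈ (trivializationAt 𝔤 K p.1).baseSet
      · congr 1
        have h1 := InvForm.map_symm_triv (trivializationAt 𝔤 K p.1) hp w
        rw [← hlb (InvForm.map (trivLieHom (trivializationAt 𝔤 K p.1) x) w), map_sum] at h1
        refine Eq.trans (Finset.sum_congr rfl fun i _ => ?_) h1
        rw [InvForm.map_kappa, linearMapAt_trivializationAt_invFormBundle _ hp]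
        rfl
      · rw [image_eq_zero_of_notMem_tsupport fun h => hp (hρ p h), zero_mul, zero_smul, zero_smul]
    refine (Finset.sum_congr rfl fun p _ => key p (σ x)).trans ?_
    rw [← Finset.sum_smul, hsum x hx, one_smul]
  · have h0 : σ x = 0 := by
      by_contra h
      exact hx (hσ (subset_closure h))
    rw [h0]
    refine Finset.sum_eq_zero fun i _ => ?_
    change kappaFiber K x (ρ i.1 x • _) _ = 0
    rw [h0]
    simp

end Decomposition

/-! ### Product and chain rules for derivatives of vector-valued functions on `M`. -/

section VectorDerivative

variable {E : Type*} [NormedAddCommGroup E] [NormedSpace ℝ E]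
  {M : Type*} [TopologicalSpace M] [ChartedSpace E M]
  {F₁ F₂ F₃ : Type*} [NormedAddCommGroup F₁] [NormedSpace ℝ F₁] [NormedAddCommGroup F₂]
  [NormedSpace ℝ F₂] [NormedAddCommGroup F₃] [NormedSpace ℝ F₃]

theorem mvfderiv_of_bilinear (B : F₁ →L[ℝ] F₂ →L[ℝ] F₃) {f : M → F₁} {g : M → F₂} {x : M}
    (hf : MDifferentiableAt 𝓘(ℝ, E) 𝓘(ℝ, F₁) f x) (hg : MDifferentiableAt 𝓘(ℝ, E) 𝓘(ℝ, F₂) g x)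
    (v : TangentSpace 𝓘(ℝ, E) x) :
    mvfderiv 𝓘(ℝ, E) (fun y => B (f y) (g y)) x v =
      B (f x) (mvfderiv 𝓘(ℝ, E) g x v) + B (mvfderiv 𝓘(ℝ, E) f x v) (g x) := by
  have hf' := hf.hasMFDerivAt
  have hg' := hg.hasMFDerivAt
  have h : HasMFDerivAt 𝓘(ℝ, E) 𝓘(ℝ, F₃) (fun y => B (f y) (g y)) x _ :=
    ⟨(B.continuous.continuousAt.comp hf'.1).clm_apply hg'.1,
      B.hasFDerivWithinAt_of_bilinear hf'.2 hg'.2⟩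
  have h' := congrArg (fun L : E →L[ℝ] F₃ => L v) h.mfderiv
  -- The rule in the chart evaluates `f` and `g` at the preimage of the chart image of `x`, which is
  -- `x`.
  simp only [extChartAt_to_inv] at h'
  exact h'

theorem mvfderiv_clm_comp (L : F₁ →L[ℝ] F₂) {f : M → F₁} {x : M}
    (hf : MDifferentiableAt 𝓘(ℝ, E) 𝓘(ℝ, F₁) f x) (v : TangentSpace 𝓘(ℝ, E) x) :
    mvfderiv 𝓘(ℝ, E) (fun y => L (f y)) x v = L (mvfderiv 𝓘(ℝ, E) f x v) := by
  have hf' := hf.hasMFDerivAt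
  have h : HasMFDerivAt 𝓘(ℝ, E) 𝓘(ℝ, F₂) (fun y => L (f y)) x _ :=
    ⟨L.continuous.continuousAt.comp hf'.1, L.hasFDerivAt.comp_hasFDerivWithinAt _ hf'.2⟩
  exact congrArg (fun L : E →L[ℝ] F₂ => L v) h.mfderiv

theorem Filter.EventuallyEq.mvfderiv_eq {f g : M → F₁} {x : M} (h : f =ᶠ[𝓝 x] g)
    (v : TangentSpace 𝓘(ℝ, E) x) :
    mvfderiv 𝓘(ℝ, E) f x v = mvfderiv 𝓘(ℝ, E) g x v :=
  congrArg (fun L : E →L[ℝ] F₁ => L v) h.mfderiv_eq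

end VectorDerivative

/-! ### Locality and local form of Koszul connections. -/

section Koszul

variable {E : Type*} [NormedAddCommGroup E] [NormedSpace ℝ E]
  {M : Type*} [TopologicalSpace M] [ChartedSpace E M]
  {F : Type*} [NormedAddCommGroup F] [NormedSpace ℝ F]
  {V : M → Type*} [TopologicalSpace (TotalSpace F V)] [∀ x, AddCommGroup (V x)]
  [∀ x, TopologicalSpace (V x)] [FiberBundle F V] [∀ x, Module ℝ (V x)] [VectorBundle ℝ F V]

theorem mdifferentiableAt_localRepresentative [ContMDiffVectorBundle ∞ F V 𝓘(ℝ, E)]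
    (e : Trivialization F (Bundle.TotalSpace.proj : TotalSpace F V → M)) [MemTrivializationAtlas e]
    {x : M} (hx : x ∈ e.baseSet) (s : CompactSection E F V) :
    MDifferentiableAt 𝓘(ℝ, E) 𝓘(ℝ, F) (fun y => (e ⟨y, s y⟩).2) x :=
  ((e.contMDiffAt_section_iff (n := ∞) (IB := 𝓘(ℝ, E)) hx).1
    (s.1.contMDiff x)).mdifferentiableAt (by simp)

variable [IsManifold 𝓘(ℝ, E) ∞ M] [∀ x, IsTopologicalAddGroup (V x)] [∀ x, ContinuousSMul ℝ (V x)]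

/-- At `x` the function has value `1` and derivative `0`, so the Leibniz rule leaves only `d η`.
This allows sections to be cut off near `x` without changing `d` there. -/
theorem IsKoszulConnection.apply_of_eventuallyEq_one
    {d : CompactSection E F V →ₗ[ℝ] CompactOneForm E F V} (hd : IsKoszulConnection d) {x : M}
    {f : C^∞⟮𝓘(ℝ, E), M; ℝ⟯} (hf : f =ᶠ[𝓝 x] 1) (η : CompactSection E F V)
    (v : TangentSpace 𝓘(ℝ, E) x) : d (f • η) x v = d η x v := by
  have h : mvfderiv 𝓘(ℝ, E) f x v = 0 := by
    rw [hf.mvfderiv_eq (f := f) v, Pi.one_def, mvfderiv_const]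
    rfl
  rw [hd, h, hf.eq_of_nhds, zero_smul, add_zero, Pi.one_apply, one_smul]

/-- In a trivialization, a Koszul connection is the derivative plus the linear map which is given
by its values on the (cut-off) constant sections. -/
theorem IsKoszulConnection.trivialization_apply [FiniteDimensional ℝ F]
    [ContMDiffVectorBundle ∞ F V 𝓘(ℝ, E)]
    {d : CompactSection E F V →ₗ[ℝ] CompactOneForm E F V} (hd : IsKoszulConnection d)
    (e : Trivialization F (Bundle.TotalSpace.proj : TotalSpace F V → M)) [MemTrivializationAtlas e]
    {f : C^∞⟮𝓘(ℝ, E), M; ℝ⟯} (hf : HasCompactSupport f) (hfe : tsupport f ⊆ e.baseSet) {x : M}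
    (hx : f =ᶠ[𝓝 x] 1) (η : CompactSection E F V) (v : TangentSpace 𝓘(ℝ, E) x) :
    (e ⟨x, d η x v⟩).2 = mvfderiv 𝓘(ℝ, E) (fun y => (e ⟨y, η y⟩).2) x v +
      (e ⟨x, d (cutoffSection e f hf hfe (e ⟨x, η x⟩).2) x v⟩).2 := by
  have hf1 : f x = 1 := hx.eq_of_nhds
  have hxe : x ∈ e.baseSet := hfe (subset_tsupport _ (by simp [hf1]))
  let b := Module.finBasis ℝ F
  let c : Fin (Module.finrank ℝ F) → F →L[ℝ] ℝ := fun i => LinearMap.toContinuousLinearMap (b.coord i)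
  -- The coordinates of `η` exist only over `e.baseSet`; the factor `f` makes them smooth functions
  -- on all of `M`.
  have hg : ∀ i, ContMDiff 𝓘(ℝ, E) 𝓘(ℝ) ∞ fun y => f y • c i (e ⟨y, η y⟩).2 := fun i =>
    contMDiff_of_tsupport fun y hy => by
      have hye : y ∈ e.baseSet := hfe (tsupport_smul_subset_left f _ hy)
      have h1 := (e.contMDiffAt_section_iff (n := ∞) (IB := 𝓘(ℝ, E)) hye).1 (η.1.contMDiff y)
      exact f.contMDiff.contMDiffAt.smul ((c i).contMDiff.contMDiffAt.comp y h1)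
  let g : Fin (Module.finrank ℝ F) → C^∞⟮𝓘(ℝ, E), M; ℝ⟯ := fun i => ⟨_, hg i⟩
  have hgx : ∀ i, g i x = b.repr (e ⟨x, η x⟩).2 i := fun i => by
    change f x • b.repr (e ⟨x, η x⟩).2 i = _
    rw [hf1, one_smul]
  -- One factor `f` globalizes the coordinate functions, the other the constant frame. Since `f = 1`
  -- near `x`, both disappear after applying `d` at `x`.
  have hsum : f • f • η = ∑ i, g i • cutoffSection e f hf hfe (b i) := by
    refine CompactSection.ext fun y => ?_
    rw [CompactSection.sum_apply]
    change f y • f y • η y = ∑ i, (f y • b.repr (e ⟨y, η y⟩).2 i) • f y • e.symmₗ ℝ y (b i)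
    by_cases hy : y ∈ e.baseSet
    · conv_lhs => rw [← e.symmₗ_apply_snd hy (η y), ← b.sum_repr (e ⟨y, η y⟩).2, map_sum,
        Finset.smul_sum, Finset.smul_sum]
      refine Finset.sum_congr rfl fun i _ => ?_
      rw [map_smul, smul_assoc, smul_comm (f y) (b.repr _ i)]
    · simp [image_eq_zero_of_notMem_tsupport fun h => hy (hfe h)]
  have h1 := congrArg (fun s : CompactSection E F V => d s x v) hsum
  simp only [map_sum] at h1
  rw [hd.apply_of_eventuallyEq_one hx, hd.apply_of_eventuallyEq_one hx] at h1
  have h2 : (∑ i, d (g i • cutoffSection e f hf hfe (b i))) x v =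
      ∑ i, (g i x • d (cutoffSection e f hf hfe (b i)) x v +
        mvfderiv 𝓘(ℝ, E) (g i) x v • cutoffSection e f hf hfe (b i) x) := by
    rw [CompactSection.sum_apply, _root_.sum_apply]
    exact Finset.sum_congr rfl fun i _ => hd _ _ _ _
  have hdg : ∀ i, mvfderiv 𝓘(ℝ, E) (g i) x v =
      b.repr (mvfderiv 𝓘(ℝ, E) (fun y => (e ⟨y, η y⟩).2) x v) i := fun i => by
    refine Eq.trans (Filter.EventuallyEq.mvfderiv_eq ?_ v)
      (mvfderiv_clm_comp (c i) (mdifferentiableAt_localRepresentative e hxe η) v)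
    filter_upwards [hx] with y hy
    change f y • c i _ = _
    rw [hy, Pi.one_apply, one_smul]
  have he : ∀ w : V x, (e ⟨x, w⟩).2 = e.linearMapAt ℝ x w := fun w => by
    rw [e.linearMapAt_apply, if_pos hxe]
  have h3 : ∀ u, cutoffSection e f hf hfe u x = e.symmₗ ℝ x u := fun u => by
    rw [cutoffSection_apply, hf1, one_smul]
  rw [h1, h2, he, map_sum, Finset.sum_congr rfl fun i _ => map_add _ _ _, Finset.sum_add_distrib,
    add_comm]
  -- The terms with `mvfderiv` of `g i` add up to the derivative of the representative of `η`; the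
  -- others add up, by linearity, to `d` of the cut-off constant section with the value of `η` at
  -- `x`.
  congr 1
  · conv_rhs => rw [← b.sum_repr (mvfderiv 𝓘(ℝ, E) (fun y => (e ⟨y, η y⟩).2) x v)]
    refine Finset.sum_congr rfl fun i _ => ?_
    rw [map_smul, hdg, h3, ← he, e.apply_symmₗ_snd hxe]
  · conv_rhs => rw [← b.sum_repr (e ⟨x, η x⟩).2, map_sum, map_sum, CompactSection.sum_apply,
      _root_.sum_apply, he, map_sum]
    refine Finset.sum_congr rfl fun i _ => ?_
    rw [map_smul, map_smul, map_smul, hgx]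
    exact (map_smul _ _ _).symm

end Koszul

/-! ### The local form of Lie connections and of `β`. -/

section Derivation

/-- The right-hand side is symmetric in `x, y` because `κ` is, and invariant because expanding `δ
⁅x, y⁆` by the derivation rule lets the invariance of `κ` be applied to each term. It therefore
factors through `κ`. -/
theorem InvForm.exists_map_of_derivation {L : Type*} [LieRing L] [LieAlgebra ℝ L] (δ : L →ₗ[ℝ] L)
    (hδ : ∀ x y, δ ⁅x, y⁆ = ⁅δ x, y⁆ + ⁅x, δ y⁆) :
    ∃ T : InvForm L →ₗ[ℝ] InvForm L, ∀ x y,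
      T (InvForm.kappa L x y) = InvForm.kappa L (δ x) y + InvForm.kappa L x (δ y) := by
  refine ⟨InvForm.lift ((InvForm.kappa L).comp δ + (InvForm.kappa L).compl₂ δ)
    (fun x y => ?_) (fun x y z => ?_), fun x y => InvForm.lift_kappa _ _ _ x y⟩
  · simp [InvForm.kappa_symm (δ x) y, InvForm.kappa_symm x (δ y), add_comm]
  · simp [hδ, InvForm.kappa_invariant, add_assoc]

variable {E : Type*} [NormedAddCommGroup E] [NormedSpace ℝ E] [FiniteDimensional ℝ E]
  {M : Type*} [TopologicalSpace M] [T2Space M] [ChartedSpace E M] [IsManifold 𝓘(ℝ, E) ∞ M]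
  {𝔤 : Type*} [NormedLieRing 𝔤] [NormedLieAlgebra 𝔤] [FiniteDimensional ℝ 𝔤]
  {K : M → Type*} [∀ x, LieRing (K x)] [∀ x, LieAlgebra ℝ (K x)] [∀ x, TopologicalSpace (K x)]
  [∀ x, IsTopologicalAddGroup (K x)] [∀ x, ContinuousSMul ℝ (K x)]
  [TopologicalSpace (TotalSpace 𝔤 K)] [FiberBundle 𝔤 K] [VectorBundle ℝ 𝔤 K]
  [LieAlgebraBundle 𝔤 K] [ContMDiffVectorBundle ∞ 𝔤 K 𝓘(ℝ, E)]

/-- In a trivialization, a Lie connection is the derivative plus a derivation of the fiber. -/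
theorem IsLieConnection.exists_derivation {D : CompactSection E 𝔤 K →ₗ[ℝ] CompactOneForm E 𝔤 K}
    (hD : IsLieConnection D) (e : Trivialization 𝔤 (Bundle.TotalSpace.proj : TotalSpace 𝔤 K → M))
    [MemTrivializationAtlas e] {x : M} (hx : x ∈ e.baseSet) (v : TangentSpace 𝓘(ℝ, E) x) :
    ∃ δ : 𝔤 →ₗ[ℝ] 𝔤, (∀ u w, δ ⁅u, w⁆ = ⁅δ u, w⁆ + ⁅u, δ w⁆) ∧ ∀ ζ : CompactSection E 𝔤 K,
      (e ⟨x, D ζ x v⟩).2 =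
        mvfderiv 𝓘(ℝ, E) (fun y => (e ⟨y, ζ y⟩).2) x v + δ (e ⟨x, ζ x⟩).2 := by
  obtain ⟨f, hf, hfe, hf1⟩ := exists_contMDiffMap_eventuallyEq_one (E := E)
    (e.open_baseSet.mem_nhds hx)
  have hfx : f x = 1 := hf1.eq_of_nhds
  refine ⟨
    { toFun := fun u => (e ⟨x, D (cutoffSection e f hf hfe u) x v⟩).2
      map_add' := fun u w => by
        rw [map_add, map_add]
        exact e.snd_add hx _ _
      map_smul' := fun a u => by
        rw [map_smul, map_smul]
        exact e.snd_smul hx _ _ }, fun u w => ?_,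
    fun ζ => hD.1.trivialization_apply e hf hfe hf1 ζ v⟩
  -- The bracket of two cut-off constant sections carries `f` twice; the extra factor is invisible
  -- to `D` at `x`, so the Lie rule for `D` becomes the derivation rule for `δ`.
  have h : ⁅cutoffSection e f hf hfe u, cutoffSection e f hf hfe w⁆ =
      f • cutoffSection e f hf hfe ⁅u, w⁆ := CompactSection.ext fun y => by
    change ⁅f y • e.symmₗ ℝ y u, f y • e.symmₗ ℝ y w⁆ = f y • f y • e.symmₗ ℝ y ⁅u, w⁆
    rw [smul_lie, lie_smul]
    congr 2
    exact ((trivSymmLieHom e y).map_lie u w).symm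
  have h1 := hD.2 (cutoffSection e f hf hfe u) (cutoffSection e f hf hfe w) x v
  rw [h, hD.1.apply_of_eventuallyEq_one hf1] at h1
  have h2 : ∀ u, (e ⟨x, cutoffSection e f hf hfe u x⟩).2 = u := fun u => by
    rw [cutoffSection_apply, hfx, one_smul, e.apply_symmₗ_snd hx]
  change (e ⟨x, D (cutoffSection e f hf hfe ⁅u, w⁆) x v⟩).2 = ⁅(e ⟨x, _⟩).2, w⁆ + ⁅u, (e ⟨x, _⟩).2⁆
  rw [h1, e.snd_add hx, LieAlgebraBundle.map_lie e x hx, LieAlgebraBundle.map_lie e x hx, h2, h2]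

/-- In a trivialization, `β(ζ, η)` is the derivative of `κ(ζ, η)` plus a linear function of
`κ(ζ, η)`. -/
theorem IsLieConnection.exists_trivialization_betaForm
    {D : CompactSection E 𝔤 K →ₗ[ℝ] CompactOneForm E 𝔤 K} (hD : IsLieConnection D) (x : M)
    (v : TangentSpace 𝓘(ℝ, E) x) :
    ∃ T : InvForm 𝔤 →ₗ[ℝ] InvForm 𝔤, ∀ ζ η : CompactSection E 𝔤 K,
      (trivializationAt (InvForm 𝔤) (InvFormBundle K) x ⟨x, betaForm D ζ η x v⟩).2 =
        mvfderiv 𝓘(ℝ, E) (fun y => (trivializationAt (InvForm 𝔤) (InvFormBundle K) x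
          ⟨y, kappaSection ζ η y⟩).2) x v +
        T (trivializationAt (InvForm 𝔤) (InvFormBundle K) x ⟨x, kappaSection ζ η x⟩).2 := by
  set e := trivializationAt 𝔤 K x with he
  have hx : x ∈ e.baseSet := FiberBundle.mem_baseSet_trivializationAt' x
  obtain ⟨δ, hδ, hDδ⟩ := hD.exists_derivation e hx v
  obtain ⟨T, hT⟩ := InvForm.exists_map_of_derivation δ hδ
  refine ⟨T, fun ζ η => ?_⟩
  have hκ : ∀ y ∈ e.baseSet, (trivializationAt (InvForm 𝔤) (InvFormBundle K) x
      ⟨y, kappaSection ζ η y⟩).2 = kappaCLM 𝔤 (e ⟨y, ζ y⟩).2 (e ⟨y, η y⟩).2 := fun y hy =>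
    trivializationAt_kappaFiber x hy _ _
  have hdκ := (Filter.EventuallyEq.mvfderiv_eq (Filter.eventuallyEq_of_mem
      (e.open_baseSet.mem_nhds hx) hκ) v).trans
    (mvfderiv_of_bilinear (kappaCLM 𝔤) (mdifferentiableAt_localRepresentative e hx ζ)
      (mdifferentiableAt_localRepresentative e hx η) v)
  have hβ : (trivializationAt (InvForm 𝔤) (InvFormBundle K) x ⟨x, betaForm D ζ η x v⟩).2 =
      kappaCLM 𝔤 (e ⟨x, D ζ x v⟩).2 (e ⟨x, η x⟩).2 +
        kappaCLM 𝔤 (e ⟨x, D η x v⟩).2 (e ⟨x, ζ x⟩).2 := by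
    rw [← trivializationAt_kappaFiber x hx, ← trivializationAt_kappaFiber x hx]
    exact (trivializationAt (InvForm 𝔤) (InvFormBundle K) x).snd_add hx
      (kappaFiber K x (D ζ x v) (η x)) (kappaFiber K x (D η x v) (ζ x))
  have hs : ∀ u w, kappaCLM 𝔤 u w = kappaCLM 𝔤 w u := InvForm.kappa_symm
  have hT' : ∀ u w, T (kappaCLM 𝔤 u w) = kappaCLM 𝔤 (δ u) w + kappaCLM 𝔤 u (δ w) := hT
  -- Symmetry of `κ` moves `D η` to the second slot; the derivative parts then form the product rule
  -- and the `δ` parts form `T`.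
  rw [hβ, hdκ, hκ x hx, hT', hDδ, hDδ, hs (_ + _) (e ⟨x, ζ x⟩).2]
  simp only [map_add, add_apply]
  abel

end Derivation

/-! ### `β` factors through `κ`. -/

section Factorization

variable {E : Type*} [NormedAddCommGroup E] [NormedSpace ℝ E]
  {M : Type*} [TopologicalSpace M] [ChartedSpace E M]
  {𝔤 : Type*} [NormedLieRing 𝔤] [NormedLieAlgebra 𝔤] [FiniteDimensional ℝ 𝔤]
  {K : M → Type*} [∀ x, LieRing (K x)] [∀ x, LieAlgebra ℝ (K x)] [∀ x, TopologicalSpace (K x)]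
  [TopologicalSpace (TotalSpace 𝔤 K)] [FiberBundle 𝔤 K] [VectorBundle ℝ 𝔤 K]
  [LieAlgebraBundle 𝔤 K]

variable (E 𝔤 K) in
/-- The linear map on `C_c^∞(M, K) ⊗ C_c^∞(M, K)` given by the bilinear form `κ_K`. -/
noncomputable def kappaSectionLift :
    CompactSection E 𝔤 K ⊗[ℝ] CompactSection E 𝔤 K →ₗ[ℝ]
      CompactSection E (InvForm 𝔤) (InvFormBundle K) :=
  TensorProduct.lift <| LinearMap.mk₂ ℝ kappaSection
    (fun ζ ζ' _ => CompactSection.ext fun x => LinearMap.map_add₂ (kappaFiber K x) (ζ x) (ζ' x) _)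
    (fun a ζ _ => CompactSection.ext fun x => LinearMap.map_smul₂ (kappaFiber K x) a (ζ x) _)
    (fun ζ η η' => CompactSection.ext fun x => map_add (kappaFiber K x (ζ x)) (η x) (η' x))
    (fun a ζ η => CompactSection.ext fun x => map_smul (kappaFiber K x (ζ x)) a (η x))

theorem kappaSectionLift_tmul (ζ η : CompactSection E 𝔤 K) :
    kappaSectionLift E 𝔤 K (ζ ⊗ₜ η) = kappaSection ζ η := rfl

theorem kappaSectionLift_surjective [FiniteDimensional ℝ E] [T2Space M] [SigmaCompactSpace M]
    [IsManifold 𝓘(ℝ, E) ∞ M] [ContMDiffVectorBundle ∞ 𝔤 K 𝓘(ℝ, E)] :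
    Function.Surjective (kappaSectionLift E 𝔤 K) := by
  intro σ
  obtain ⟨ι, _, Φ, hΦ, ε, h⟩ := exists_sum_kappaSection 𝔤 K (E := E)
    ⟨sectionSupport σ.1, σ.2⟩
  refine ⟨∑ i, (hΦ i).mapCompactSection σ ⊗ₜ ε i, ?_⟩
  rw [map_sum]
  exact h σ subset_rfl

variable [FiniteDimensional ℝ E] [IsManifold 𝓘(ℝ, E) ∞ M] [∀ x, IsTopologicalAddGroup (K x)]
  [∀ x, ContinuousSMul ℝ (K x)]

theorem betaForm_apply (D : CompactSection E 𝔤 K →ₗ[ℝ] CompactOneForm E 𝔤 K)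
    (ζ η : CompactSection E 𝔤 K) (x : M) (v : TangentSpace 𝓘(ℝ, E) x) :
    betaForm D ζ η x v = kappaFiber K x (D ζ x v) (η x) + kappaFiber K x (D η x v) (ζ x) := rfl

/-- The linear map on `C_c^∞(M, K) ⊗ C_c^∞(M, K)` given by the bilinear form `β`. -/
noncomputable def betaFormLift (D : CompactSection E 𝔤 K →ₗ[ℝ] CompactOneForm E 𝔤 K) :
    CompactSection E 𝔤 K ⊗[ℝ] CompactSection E 𝔤 K →ₗ[ℝ]
      CompactOneForm E (InvForm 𝔤) (InvFormBundle K) :=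
  TensorProduct.lift <| LinearMap.mk₂ ℝ (betaForm D)
    (fun ζ ζ' η => CompactSection.ext fun x => ContinuousLinearMap.ext fun v => by
      refine Eq.trans ?_ (congrArg₂ (· + ·) (betaForm_apply D ζ η x v)
        (betaForm_apply D ζ' η x v)).symm
      rw [betaForm_apply, map_add]
      refine (congrArg₂ (· + ·) (LinearMap.map_add₂ (kappaFiber K x) (D ζ x v) (D ζ' x v) _)
        (map_add (kappaFiber K x _) (ζ x) (ζ' x))).trans ?_
      abel)
    (fun a ζ η => CompactSection.ext fun x => ContinuousLinearMap.ext fun v => by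
      refine Eq.trans ?_ (congrArg (a • ·) (betaForm_apply D ζ η x v)).symm
      rw [betaForm_apply, map_smul]
      refine (congrArg₂ (· + ·) (LinearMap.map_smul₂ (kappaFiber K x) a (D ζ x v) _)
        (map_smul (kappaFiber K x _) a (ζ x))).trans (smul_add _ _ _).symm)
    (fun ζ η η' => CompactSection.ext fun x => ContinuousLinearMap.ext fun v => by
      refine Eq.trans ?_ (congrArg₂ (· + ·) (betaForm_apply D ζ η x v)
        (betaForm_apply D ζ η' x v)).symm
      rw [betaForm_apply, map_add]
      refine (congrArg₂ (· + ·) (map_add (kappaFiber K x _) (η x) (η' x))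
        (LinearMap.map_add₂ (kappaFiber K x) (D η x v) (D η' x v) _)).trans ?_
      abel)
    (fun a ζ η => CompactSection.ext fun x => ContinuousLinearMap.ext fun v => by
      refine Eq.trans ?_ (congrArg (a • ·) (betaForm_apply D ζ η x v)).symm
      rw [betaForm_apply, map_smul]
      refine (congrArg₂ (· + ·) (map_smul (kappaFiber K x _) a (η x))
        (LinearMap.map_smul₂ (kappaFiber K x) a (D η x v) _)).trans (smul_add _ _ _).symm)

theorem betaFormLift_tmul (D : CompactSection E 𝔤 K →ₗ[ℝ] CompactOneForm E 𝔤 K)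
    (ζ η : CompactSection E 𝔤 K) : betaFormLift D (ζ ⊗ₜ η) = betaForm D ζ η := rfl

/-- Both sides of the local formula for `β` are additive, so it extends from pure tensors to all
tensors `t`. Its right-hand side sees `t` only through `kappaSectionLift E 𝔤 K t`, hence `t` and `0`
have the same image under `betaFormLift D` when that section vanishes. -/
theorem IsLieConnection.ker_kappaSectionLift_le [T2Space M] [ContMDiffVectorBundle ∞ 𝔤 K 𝓘(ℝ, E)]
    {D : CompactSection E 𝔤 K →ₗ[ℝ] CompactOneForm E 𝔤 K} (hD : IsLieConnection D) :
    LinearMap.ker (kappaSectionLift E 𝔤 K) ≤ LinearMap.ker (betaFormLift D) := by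
  intro t ht
  refine CompactSection.ext fun x => ContinuousLinearMap.ext fun v => ?_
  obtain ⟨T, hT⟩ := hD.exists_trivialization_betaForm x v
  set e := trivializationAt (InvForm 𝔤) (InvFormBundle K) x
  have hx : x ∈ e.baseSet := FiberBundle.mem_baseSet_trivializationAt' x
  have key : ∀ t, (e ⟨x, betaFormLift D t x v⟩).2 =
      mvfderiv 𝓘(ℝ, E) (fun y => (e ⟨y, kappaSectionLift E 𝔤 K t y⟩).2) x v +
        T (e ⟨x, kappaSectionLift E 𝔤 K t x⟩).2 := by
    intro t
    induction t using TensorProduct.induction_on with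
    | zero => rw [← TensorProduct.zero_tmul (CompactSection E 𝔤 K) 0]; exact hT 0 0
    | tmul ζ η => exact hT ζ η
    | add t₁ t₂ h₁ h₂ =>
      have hadd : ∀ y ∈ e.baseSet, (e ⟨y, kappaSectionLift E 𝔤 K (t₁ + t₂) y⟩).2 =
          (e ⟨y, kappaSectionLift E 𝔤 K t₁ y⟩).2 + (e ⟨y, kappaSectionLift E 𝔤 K t₂ y⟩).2 :=
        fun y hy => by rw [map_add]; exact e.snd_add hy _ _
      have hdadd := (Filter.EventuallyEq.mvfderiv_eq (Filter.eventuallyEq_of_mem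
        (e.open_baseSet.mem_nhds hx) hadd) v).trans (congrArg (· v) (mvfderiv_add
          (mdifferentiableAt_localRepresentative e hx (kappaSectionLift E 𝔤 K t₁))
          (mdifferentiableAt_localRepresentative e hx (kappaSectionLift E 𝔤 K t₂))))
      rw [hdadd, hadd x hx, map_add T, map_add (betaFormLift D)]
      refine (e.snd_add hx _ _).trans ((congrArg₂ (· + ·) h₁ h₂).trans ?_)
      rw [add_apply]
      exact add_add_add_comm _ _ _ _
  have h := key t
  -- The right-hand side is recognized as the formula for the tensor `0`, where `β` is zero.
  rw [LinearMap.mem_ker.1 ht, ← LinearMap.map_zero (kappaSectionLift E 𝔤 K), ← key 0,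
    map_zero] at h
  have h' := congrArg (e.symmₗ ℝ x) h
  rwa [e.symmₗ_apply_snd hx, e.symmₗ_apply_snd hx] at h'

end Factorization

/-! ### Existence, continuity and uniqueness of the induced connection. -/

theorem mainTheorem5
    {E : Type*} [NormedAddCommGroup E] [NormedSpace ℝ E] [FiniteDimensional ℝ E]
    {M : Type*} [TopologicalSpace M] [T2Space M] [SigmaCompactSpace M]
    [ChartedSpace E M] [IsManifold 𝓘(ℝ, E) ∞ M]
    {𝔤 : Type*} [NormedLieRing 𝔤] [NormedLieAlgebra 𝔤] [FiniteDimensional ℝ 𝔤]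
    (hperfect : ⁅(⊤ : LieIdeal ℝ 𝔤), (⊤ : LieIdeal ℝ 𝔤)⁆ = ⊤)
    {K : M → Type*} [∀ x, LieRing (K x)] [∀ x, LieAlgebra ℝ (K x)]
    [∀ x, TopologicalSpace (K x)] [∀ x, IsTopologicalAddGroup (K x)]
    [∀ x, ContinuousSMul ℝ (K x)] [TopologicalSpace (TotalSpace 𝔤 K)]
    [FiberBundle 𝔤 K] [VectorBundle ℝ 𝔤 K] [ContMDiffVectorBundle ∞ 𝔤 K 𝓘(ℝ, E)]
    [LieAlgebraBundle 𝔤 K]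
    (D : CompactSection E 𝔤 K →ₗ[ℝ] CompactOneForm E 𝔤 K)
    (hD : IsLieConnection D) (hDc : Continuous D) :
    ∃! d : CompactSection E (InvForm 𝔤) (InvFormBundle K) →ₗ[ℝ]
        CompactOneForm E (InvForm 𝔤) (InvFormBundle K),
      Continuous d ∧ IsKoszulConnection d ∧
        ∀ ζ η : CompactSection E 𝔤 K, d (kappaSection ζ η) = betaForm D ζ η := by
  have hsurj := kappaSectionLift_surjective (E := E) (𝔤 := 𝔤) (K := K)
  obtain ⟨g, hg⟩ := LinearMap.exists_rightInverse_of_surjective _ (LinearMap.range_eq_top.2 hsurj)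
  -- The purely algebraic right inverse `g` may be arbitrary: two preimages of a section differ by
  -- an element of the kernel of `κ`, on which `β` vanishes.
  have hd : ∀ t, betaFormLift D (g (kappaSectionLift E 𝔤 K t)) = betaFormLift D t := fun t => by
    have h : g (kappaSectionLift E 𝔤 K t) - t ∈ LinearMap.ker (kappaSectionLift E 𝔤 K) := by
      rw [LinearMap.mem_ker, map_sub, sub_eq_zero]
      exact LinearMap.congr_fun hg _
    have h' := hD.ker_kappaSectionLift_le h
    rwa [LinearMap.mem_ker, map_sub, sub_eq_zero] at h'
  refine ⟨betaFormLift D ∘ₗ g, ⟨?_, ?_, fun ζ η => hd (ζ ⊗ₜ η)⟩, fun d' hd' => ?_⟩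
  · refine CompactSection.continuous_of_forall_supportedIn _ fun A => ?_
    -- Continuity of `g` is not available. On sections supported in `A` it is bypassed by the
    -- preimage `∑ Φᵢ σ ⊗ εᵢ`, which yields the same value of `d` and depends continuously on `σ`
    -- after applying `β`.
    obtain ⟨ι, _, Φ, hΦ, ε, h⟩ := exists_sum_kappaSection 𝔤 K (E := E) A
    have hc : Continuous fun σ => ∑ i, betaForm D ((hΦ i).mapCompactSection σ) (ε i) :=
      continuous_finsetSum _ fun i _ =>
        (continuous_betaForm_left hDc (ε i)).comp (hΦ i).continuous_mapCompactSection
    let _ : TopologicalSpace (sectionsSupportedIn E (InvForm 𝔤) (InvFormBundle K) A) :=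
      TopologicalSpace.induced Subtype.val (smoothSectionTopology E (InvForm 𝔤) (InvFormBundle K))
    refine (hc.comp (CompactSection.continuous_ofSupportedIn A)).congr fun s => ?_
    have hs := (map_sum (kappaSectionLift E 𝔤 K) (fun i => (hΦ i).mapCompactSection
      (CompactSection.ofSupportedIn E (InvForm 𝔤) (InvFormBundle K) A s) ⊗ₜ[ℝ] ε i) _).trans <|
      h (CompactSection.ofSupportedIn E (InvForm 𝔤) (InvFormBundle K) A s) s.2
    conv_rhs => rw [LinearMap.comp_apply, ← hs, hd, map_sum]
    rfl
  · intro f σ x v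
    obtain ⟨t, rfl⟩ := hsurj σ
    -- This reduces the Leibniz rule on pure tensors to that of `D (f • ζ)`: the term with the
    -- derivative of `f` contributes exactly its product with `κ(ζ, η)`.
    have h0 : ∀ ζ η : CompactSection E 𝔤 K, f • kappaSection ζ η = kappaSection (f • ζ) η :=
      fun ζ η => CompactSection.ext fun y =>
        (LinearMap.map_smul₂ (kappaFiber K y) (f y) (ζ y) (η y)).symm
    change betaFormLift D (g (f • kappaSectionLift E 𝔤 K t)) x v =
      f x • betaFormLift D (g (kappaSectionLift E 𝔤 K t)) x v + _
    rw [hd]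
    induction t using TensorProduct.induction_on with
    | zero =>
      have h1 : f • kappaSectionLift E 𝔤 K 0 = 0 := by
        rw [map_zero]
        exact CompactSection.ext fun y => smul_zero (f y)
      rw [h1, map_zero, map_zero, map_zero]
      exact ((congrArg₂ (· + ·) (smul_zero (f x)) (smul_zero _)).trans (add_zero _)).symm
    | tmul ζ η =>
      rw [kappaSectionLift_tmul, h0, ← kappaSectionLift_tmul, hd, betaFormLift_tmul]
      have h1 := betaForm_apply D (f • ζ) η x v
      rw [hD.1] at h1
      refine h1.trans ((congrArg₂ (· + ·) ((LinearMap.map_add₂ (kappaFiber K x) _ _ _).trans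
        (congrArg₂ (· + ·) (LinearMap.map_smul₂ (kappaFiber K x) _ _ _)
          (LinearMap.map_smul₂ (kappaFiber K x) _ _ _)))
        (map_smul (kappaFiber K x (D η x v)) (f x) (ζ x))).trans ?_)
      rw [betaFormLift_tmul, betaForm_apply, smul_add]
      exact add_right_comm _ _ _
    | add t₁ t₂ h₁ h₂ =>
      have h2 : f • kappaSectionLift E 𝔤 K (t₁ + t₂) =
          f • kappaSectionLift E 𝔤 K t₁ + f • kappaSectionLift E 𝔤 K t₂ := by
        rw [map_add]
        exact CompactSection.ext fun y => smul_add (f y) _ _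
      rw [h2, map_add, map_add, map_add, map_add]
      refine (congrArg₂ (· + ·) h₁ h₂).trans ?_
      refine Eq.trans ?_ (congrArg₂ (· + ·) (smul_add (f x) _ _).symm (smul_add _ _ _).symm)
      exact add_add_add_comm _ _ _ _
  · refine LinearMap.ext fun σ => ?_
    obtain ⟨t, rfl⟩ := hsurj σ
    -- The values on all `κ(ζ, η)` determine `d'`, because these sections span.
    refine (LinearMap.congr_fun (f := d' ∘ₗ kappaSectionLift E 𝔤 K)
      (g := betaFormLift D) (TensorProduct.ext' fun ζ η => hd'.2.2 ζ η) t).trans (hd t).symm
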